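/- Theorem (Asymptotic Efficiency). Let $\mathcal S$ and $\mathcal A$ be finite, let $0\le\gamma<1$ and $T\ge1$, let $\pi(a\mid s)$ be a fixed (possibly randomized) policy, and let $\sigma^2(s,a)\in[0,\infty)$ be given. A parameter $\theta=(P,r)$ consists of transition probabilities $P(s'\mid s,a)$ with $\sum_{s'}P(s'\mid s,a)=1$ and mean rewards $r(s,a)$; put $P^\pi(s,s')=\sum_a P(s'\mid s,a)\pi(a\mid s)$. The model $\Theta$ is the set of all $\theta$ for which the chain $P^\pi$ is irreducible. Under $\theta$ the trajectory $\tau=\{(s_i,a_i,s_{i+1},r_i)\}_{i=1}^{T}$ has $a_i\sim\pi(\cdot\mid s_i)$, $s_{i+1}\sim P(\cdot\mid s_i,a_i)$ and, independently given states and actions, $r_i\sim\mathcal N(r(s_i,a_i),\sigma^2(s_i,a_i))$. Let $V^\pi_\theta(s)=\mathbb E_\theta\big[\sum_{i\ge0}\gamma^i r(s_i,a_i)\mid s_0=s\big]$. Fix a true parameter $\theta\in\Theta$ with stationary distribution $\mu$ of $P^\pi$, and for every $\theta'\in\Theta$ let $\mathbb E_{\theta'}$ refer to the trajectory with initial distribution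 $s_1\sim\mu$ (the initial distribution is held fixed when $\theta'$ varies). With $V=V^\pi_\theta$, $\sigma_\pi^2(s)=\sum_a\pi(a\mid s)\sigma^2(s,a)$, $p_s=P^\pi(s,\cdot)$, $\Sigma_{p_s}=\mathrm{Diag}(p_s)-p_sp_s^\top$ and $\|x\|_A^2=x^\top Ax$, let $$\Sigma_{\mathrm{MB}}=(I-\gamma P^\pi)^{-1}\,\mathrm{Diag}_{s}\Big(\tfrac{\sigma_\pi^2(s)}{\mu(s)}+\tfrac{\|\gamma V\|^2_{\Sigma_{p_s}}}{\mu(s)}\Big)\,(I-\gamma P^\pi)^{-\top}.$$ Let $\widehat V=\widehat V(\tau)$ be a measurable estimator that is square integrable under $\theta$, with covariance matrix $\Sigma$ under $\theta$. (1) If $\widehat V$ is unbiased, that is, $\mathbb E_{\theta'}\widehat V=V^\pi_{\theta'}$ for all $\theta'\in\Theta$ (with $\widehat V$ integrable under each $\theta'$), then $\Sigma_{\mathrm{MB}}\preceq T\,\Sigma$. (2) Suppose that for all $s$ the transition probabilities $P(\cdot\mid s,a)$ are the same for all actions $a$ with $\pi(a\mid s)>0$ (for instance, $\pi$ is deterministic).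 If $\widehat V$ is only unbiased to first order at $\theta$, that is, $\widehat V$ is integrable under every $\theta'\in\Theta$ near $\theta$ and $\mathbb E_{\theta'}\widehat V-V^\pi_{\theta'}=o(\|\theta'-\theta\|)$ as $\theta'\to\theta$ in $\Theta$, then again $\Sigma_{\mathrm{MB}}\preceq T\,\Sigma$. -/

import Mathlib

open MeasureTheory ProbabilityTheory Topology Asymptotics Matrix
open scoped NNReal ENNReal

noncomputable section

/-- The unknown parameters `(P, r)` of a finite Markov decision process: `P s a s'` is the
probability of moving from `s` to `s'` under action `a`, and `r s a` is the mean reward. -/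
abbrev MDPParam (S A : Type*) := (S → A → S → ℝ) × (S → A → ℝ)

/-- `P s a ·` is a probability vector for all `s` and `a`. -/
def IsTransition {S A : Type*} [Fintype S] (P : S → A → S → ℝ) : Prop :=
  (∀ s a s', 0 ≤ P s a s') ∧ ∀ s a, ∑ s', P s a s' = 1

/-- A (possibly randomized) stationary policy: `π s a` is the probability of `a` in state `s`. -/
def IsPolicy {S A : Type*} [Fintype A] (π : S → A → ℝ) : Prop :=
  (∀ s a, 0 ≤ π s a) ∧ ∀ s, ∑ a, π s a = 1

/-- The transition matrix `P^π` of the chain of states under the policy. -/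
def policyMatrix {S A : Type*} [Fintype A] (π : S → A → ℝ) (P : S → A → S → ℝ) : Matrix S S ℝ :=
  Matrix.of fun s s' => ∑ a, P s a s' * π s a

/-- The reward variance `σ_π²(s) = ∑ₐ π(a | s) σ²(s, a)`. -/
def policyVar {S A : Type*} [Fintype A] (π : S → A → ℝ) (σ2 : S → A → ℝ≥0) (s : S) : ℝ :=
  ∑ a, π s a * (σ2 s a : ℝ)

/-- Irreducibility of a finite Markov chain: every state is reached from every state. -/
def IsIrreducibleChain {S : Type*} [Fintype S] [DecidableEq S] (Q : Matrix S S ℝ) : Prop :=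
  ∀ s s', ∃ n : ℕ, 0 < (Q ^ n) s s'

/-- `μ` is a stationary probability vector of the chain with transition matrix `Q`. -/
def IsStationaryDist {S : Type*} [Fintype S] (Q : Matrix S S ℝ) (μ : S → ℝ) : Prop :=
  (∀ s, 0 ≤ μ s) ∧ ∑ s, μ s = 1 ∧ μ ᵥ* Q = μ

/-- A trajectory with `T` transitions: the states `s_0, …, s_T`, the actions `a_0, …, a_{T-1}`
and the observed rewards `r_0, …, r_{T-1}`. It carries the same data as the `T` tuples
`(s_i, a_i, s_{i+1}, r_i)`. -/
abbrev Trajectory (S A : Type*) (T : ℕ) := (Fin (T + 1) → S) × (Fin T → A) × (Fin T → ℝ)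

/-- The probability of the given states and actions, when the initial state has law `ν`. -/
def pathProb {S A : Type*} {T : ℕ} (π : S → A → ℝ) (ν : S → ℝ) (P : S → A → S → ℝ)
    (s : Fin (T + 1) → S) (a : Fin T → A) : ℝ :=
  ν (s 0) * ∏ t : Fin T, π (s t.castSucc) (a t) * P (s t.castSucc) (a t) (s t.succ)

/-- The law of a trajectory of length `T` under the policy `π`, started from the law `ν`. Given
the states and actions, the rewards are independent, the one at time `t` being Gaussian with
mean `r (s_t) (a_t)` and variance `σ2 (s_t) (a_t)`. -/
def trajLaw {S A : Type*} [Fintype S] [Fintype A] [MeasurableSpace S] [MeasurableSpace A]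
    (T : ℕ) (π : S → A → ℝ) (σ2 : S → A → ℝ≥0) (ν : S → ℝ) (θ : MDPParam S A) :
    Measure (Trajectory S A T) :=
  ∑ s : Fin (T + 1) → S, ∑ a : Fin T → A,
    ENNReal.ofReal (pathProb π ν θ.1 s a) •
      (Measure.dirac s).prod ((Measure.dirac a).prod
        (Measure.pi fun t : Fin T =>
          gaussianReal (θ.2 (s t.castSucc) (a t)) (σ2 (s t.castSucc) (a t))))

/-- The value function `V^π(s) = ∑ᵢ γⁱ 𝔼[r(s_i, a_i) | s_0 = s]`. The state and action spaces are
finite and `γ < 1`, so the sum may be taken outside the expectation. The expectation at time `i`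
is under the law of the first `i + 1` transitions, started at `s`. -/
def valueFn {S A : Type*} [Fintype S] [Fintype A] [DecidableEq S]
    [MeasurableSpace S] [MeasurableSpace A]
    (γ : ℝ) (π : S → A → ℝ) (σ2 : S → A → ℝ≥0) (θ : MDPParam S A) (s : S) : ℝ :=
  ∑' i : ℕ, γ ^ i *
    ∫ τ, θ.2 (τ.1 (Fin.last i).castSucc) (τ.2.1 (Fin.last i))
      ∂(trajLaw (i + 1) π σ2 (Pi.single s 1) θ)

/-- The covariance matrix `Diag(p) - p pᵀ` of one draw from the probability vector `p`. -/
def multinomialCov {S : Type*} [DecidableEq S] (p : S → ℝ) : Matrix S S ℝ :=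
  Matrix.diagonal p - Matrix.vecMulVec p p

/-- `Σ_MB = (I - γP^π)⁻¹ Diag_s((σ_π²(s) + ‖γV^π‖²_{Σ_{p(s)}}) / μ(s)) (I - γP^π)⁻ᵀ`, where
`‖x‖²_A = xᵀ A x` and `p(s)` is the row of `P^π` at `s`. -/
def sigmaMB {S A : Type*} [Fintype S] [Fintype A] [DecidableEq S]
    [MeasurableSpace S] [MeasurableSpace A]
    (γ : ℝ) (π : S → A → ℝ) (σ2 : S → A → ℝ≥0) (μ : S → ℝ) (θ : MDPParam S A) :
    Matrix S S ℝ :=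
  let Q := policyMatrix π θ.1
  let V := valueFn γ π σ2 θ
  (1 - γ • Q)⁻¹ *
    Matrix.diagonal (fun s =>
      policyVar π σ2 s / μ s + ((γ • V) ⬝ᵥ (multinomialCov (Q s) *ᵥ (γ • V))) / μ s) *
    ((1 - γ • Q)⁻¹)ᵀ

/-- The statistical model: all `(P, r)` whose chain of states under `π` is irreducible (the
row-sum constraints on `P` are part of `IsTransition`). -/
def irreducibleModel {S A : Type*} [Fintype S] [Fintype A] [DecidableEq S] (π : S → A → ℝ) :
    Set (MDPParam S A) :=
  {θ | IsTransition θ.1 ∧ IsIrreducibleChain (policyMatrix π θ.1)}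

/-- `f` is an unbiased estimator of the value function from trajectories of length `T` with
initial law `ν`: its mean is the value function for every parameter of the model. -/
def IsUnbiased {S A : Type*} [Fintype S] [Fintype A] [DecidableEq S]
    [MeasurableSpace S] [MeasurableSpace A] {T : ℕ}
    (γ : ℝ) (π : S → A → ℝ) (σ2 : S → A → ℝ≥0) (ν : S → ℝ)
    (f : Trajectory S A T → S → ℝ) : Prop :=
  ∀ θ ∈ irreducibleModel π, Integrable f (trajLaw T π σ2 ν θ) ∧
    ∫ τ, f τ ∂(trajLaw T π σ2 ν θ) = valueFn γ π σ2 θ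

/-- `f` is unbiased to first order at `θ`: its bias at `θ'` is `o(‖θ' - θ‖)` as `θ'` tends to `θ`
in the model. For `θ` in the model this includes that the bias at `θ` is zero. -/
def IsLocallyUnbiased {S A : Type*} [Fintype S] [Fintype A] [DecidableEq S]
    [MeasurableSpace S] [MeasurableSpace A] {T : ℕ}
    (γ : ℝ) (π : S → A → ℝ) (σ2 : S → A → ℝ≥0) (ν : S → ℝ) (θ : MDPParam S A)
    (f : Trajectory S A T → S → ℝ) : Prop :=
  (∀ᶠ θ' in 𝓝[irreducibleModel π] θ, Integrable f (trajLaw T π σ2 ν θ')) ∧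
    (fun θ' => (∫ τ, f τ ∂(trajLaw T π σ2 ν θ')) - valueFn γ π σ2 θ')
      =o[𝓝[irreducibleModel π] θ] fun θ' => θ' - θ

/-- The covariance matrix of the estimator `f` under the measure `P`. -/
def estimatorCov {S Ω : Type*} [MeasurableSpace Ω] (f : Ω → S → ℝ) (P : Measure Ω) :
    Matrix S S ℝ :=
  Matrix.of fun s s' => covariance (fun τ => f τ s) (fun τ => f τ s') P

end

/-! ### Sums over paths -/

/-! The local bound is a Chapman–Robbins inequality along a least favourable curve through `θ`. For
a fixed direction `x`, put `M = 1 - γ • P^π`, `w = x ᵥ* M⁻¹`, `c = w / μ` and `u = γ • V`. The curve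
`tiltParam` multiplies `P(s' | s, a)` by `1 + ε c(s) (u(s') - (Pu)(s, a))` and adds `ε c(s) σ²(s,
a)` to the mean reward. Rewards of variance zero are thus not moved, and each tilted law has a
square integrable density with respect to the law at `θ`.

Two limits are needed, both expressed by `infoVar`, written `B`. The Bellman equation gives the
slope of `x ⬝ᵥ V` along the curve, `J = ∑ w² B / μ` (`tendsto_valueFn_tiltParam_slope`), and
first-order unbiasedness makes this also the slope of the mean of the estimator. The second moment
of the likelihood ratio is a sum over paths of products of step weights, hence `μ ⬝ᵥ K_ε ^ T *ᵥ 1`;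
stationarity of `μ` turns its expansion into `1 + ε² T J + o(ε²)`
(`tendsto_dotProduct_tiltKernel_pow`). Inserting both into `variance_tilt_quadratic_nonneg` with
multiplier `1 / (T ε)` and letting `ε → 0` yields `J ≤ T * variance`
(`posSemidef_sub_of_isLocallyUnbiased`).

This bound averages the variance of `u` over the actions, whereas `sigmaMB` takes the variance under
the averaged law, which by the law of total variance can be larger. The two agree if the actions in
use share their transition law, which settles the second claim. The first claim has no such
hypothesis. It reduces to the local bound when `γ = 0` or there is at most one state, and otherwise
it is vacuous: expectations are polynomial in `P`, but on the line `lazyParam` the value function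
has a pole at `1 / γ` (`not_isUnbiased`). -/

lemma sum_path_succ {S A M : Type*} [Fintype S] [Fintype A] [AddCommMonoid M] {T : ℕ}
    (G : (Fin (T + 2) → S) → (Fin (T + 1) → A) → M) :
    ∑ s, ∑ a, G s a = ∑ s₀, ∑ a₀, ∑ s : Fin (T + 1) → S, ∑ a : Fin T → A,
      G (Fin.cons s₀ s) (Fin.cons a₀ a) := by
  rw [← (Fin.consEquiv fun _ : Fin (T + 2) => S).sum_comp, Fintype.sum_prod_type]
  refine Finset.sum_congr rfl fun s₀ _ => ?_
  rw [Finset.sum_comm (s := (Finset.univ : Finset A))]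
  refine Finset.sum_congr rfl fun s _ => ?_
  rw [← (Fin.consEquiv fun _ : Fin (T + 1) => A).sum_comp, Fintype.sum_prod_type]
  rfl

/-- The matrix of total weights of the one-step transitions weighted by `k`. -/
def stepMatrix {S A : Type*} [Fintype A] (k : S → A → S → ℝ) : Matrix S S ℝ :=
  Matrix.of fun s s' => ∑ a, k s a s'

lemma stepMatrix_mulVec {S A : Type*} [Fintype S] [Fintype A] (k : S → A → S → ℝ) (v : S → ℝ)
    (s : S) : (stepMatrix k *ᵥ v) s = ∑ a, ∑ s', k s a s' * v s' := by
  simp only [mulVec, dotProduct, stepMatrix, of_apply, Finset.sum_mul]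
  exact Finset.sum_comm

/-- The weights `k` need not be probabilities: the same formula gives the total mass of the path law
and the second moment of a likelihood ratio. -/
lemma sum_path_prod {S A : Type*} [Fintype S] [Fintype A] [DecidableEq S] (k : S → A → S → ℝ)
    (T : ℕ) (ν : S → ℝ) :
    ∑ s : Fin (T + 1) → S, ∑ a : Fin T → A,
      ν (s 0) * ∏ t : Fin T, k (s t.castSucc) (a t) (s t.succ) =
    ν ⬝ᵥ (stepMatrix k ^ T *ᵥ 1) := by
  induction T generalizing ν with
  | zero =>
    rw [← (Fin.consEquiv fun _ : Fin 1 => S).sum_comp, Fintype.sum_prod_type]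
    simp [dotProduct]
  | succ T ih =>
    rw [sum_path_succ]
    have h : ∀ s₀ a₀, ∑ s : Fin (T + 1) → S, ∑ a : Fin T → A,
        ν ((Fin.cons s₀ s : Fin (T + 2) → S) 0) * ∏ t : Fin (T + 1),
          k ((Fin.cons s₀ s : Fin (T + 2) → S) t.castSucc) ((Fin.cons a₀ a : Fin (T + 1) → A) t)
            ((Fin.cons s₀ s : Fin (T + 2) → S) t.succ) =
        ν s₀ * (k s₀ a₀ ⬝ᵥ (stepMatrix k ^ T *ᵥ 1)) := by
      intro s₀ a₀
      -- After the first step the path starts afresh with initial weights `k s₀ a₀`, which is why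
      -- `ν` is arbitrary in the induction.
      rw [← ih, Finset.mul_sum]
      refine Finset.sum_congr rfl fun s _ => ?_
      rw [Finset.mul_sum]
      refine Finset.sum_congr rfl fun a _ => ?_
      rw [Fin.prod_univ_succ]
      simp
    simp_rw [h, ← Finset.mul_sum]
    rw [pow_succ', ← mulVec_mulVec]
    refine Finset.sum_congr rfl fun s _ => ?_
    rw [stepMatrix_mulVec]
    rfl

lemma sum_path_prod_mul_last {S A : Type*} [Fintype S] [Fintype A] [DecidableEq S]
    (k : S → A → S → ℝ) (g : S → A → ℝ) (i : ℕ) (ν : S → ℝ) :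
    ∑ s : Fin (i + 2) → S, ∑ a : Fin (i + 1) → A,
      (ν (s 0) * ∏ t : Fin (i + 1), k (s t.castSucc) (a t) (s t.succ)) *
        g (s (Fin.last i).castSucc) (a (Fin.last i)) =
    ν ⬝ᵥ (stepMatrix k ^ i *ᵥ fun s => ∑ a, (∑ s', k s a s') * g s a) := by
  induction i generalizing ν with
  | zero =>
    rw [sum_path_succ]
    have h : ∀ s₀ a₀, ∑ s : Fin 1 → S, ∑ a : Fin 0 → A,
        (ν ((Fin.cons s₀ s : Fin 2 → S) 0) * ∏ t : Fin 1,
          k ((Fin.cons s₀ s : Fin 2 → S) t.castSucc) ((Fin.cons a₀ a : Fin 1 → A) t)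
            ((Fin.cons s₀ s : Fin 2 → S) t.succ)) *
          g ((Fin.cons s₀ s : Fin 2 → S) (Fin.last 0).castSucc)
            ((Fin.cons a₀ a : Fin 1 → A) (Fin.last 0)) =
        ν s₀ * ((∑ s', k s₀ a₀ s') * g s₀ a₀) := by
      intro s₀ a₀
      have := sum_path_prod k 0 (k s₀ a₀)
      simp only [Finset.univ_eq_empty, Finset.prod_empty, mul_one, pow_zero, one_mulVec,
        dotProduct_one] at this
      rw [← this, Finset.sum_mul, Finset.mul_sum]
      refine Finset.sum_congr rfl fun s _ => ?_
      rw [Finset.sum_mul, Finset.mul_sum]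
      refine Finset.sum_congr rfl fun a _ => ?_
      simp [mul_assoc]
    simp_rw [h]
    simp [dotProduct, Finset.mul_sum]
  | succ i ih =>
    rw [sum_path_succ]
    have h : ∀ s₀ a₀, ∑ s : Fin (i + 2) → S, ∑ a : Fin (i + 1) → A,
        (ν ((Fin.cons s₀ s : Fin (i + 3) → S) 0) * ∏ t : Fin (i + 2),
          k ((Fin.cons s₀ s : Fin (i + 3) → S) t.castSucc) ((Fin.cons a₀ a : Fin (i + 2) → A) t)
            ((Fin.cons s₀ s : Fin (i + 3) → S) t.succ)) *
          g ((Fin.cons s₀ s : Fin (i + 3) → S) (Fin.last (i + 1)).castSucc)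
            ((Fin.cons a₀ a : Fin (i + 2) → A) (Fin.last (i + 1))) =
        ν s₀ * (k s₀ a₀ ⬝ᵥ (stepMatrix k ^ i *ᵥ fun s => ∑ a, (∑ s', k s a s') * g s a)) := by
      intro s₀ a₀
      rw [← ih, Finset.mul_sum]
      refine Finset.sum_congr rfl fun s _ => ?_
      rw [Finset.mul_sum]
      refine Finset.sum_congr rfl fun a _ => ?_
      rw [Fin.prod_univ_succ, ← Fin.succ_last, ← Fin.succ_castSucc]
      simp [mul_assoc]
    simp_rw [h, ← Finset.mul_sum]
    rw [pow_succ', ← mulVec_mulVec]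
    refine Finset.sum_congr rfl fun s _ => ?_
    rw [stepMatrix_mulVec]
    rfl

lemma policyMatrix_eq_stepMatrix {S A : Type*} [Fintype A] (π : S → A → ℝ) (P : S → A → S → ℝ) :
    policyMatrix π P = stepMatrix fun s a s' => π s a * P s a s' := by
  ext s s'
  simp [policyMatrix, stepMatrix, mul_comm]

lemma sum_pathProb_mul_last {S A : Type*} [Fintype S] [Fintype A] [DecidableEq S]
    (π : S → A → ℝ) {P : S → A → S → ℝ} (hP : IsTransition P) (g : S → A → ℝ) (i : ℕ)
    (ν : S → ℝ) :
    ∑ s : Fin (i + 2) → S, ∑ a : Fin (i + 1) → A,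
      pathProb π ν P s a * g (s (Fin.last i).castSucc) (a (Fin.last i)) =
    ν ⬝ᵥ (policyMatrix π P ^ i *ᵥ fun s => ∑ a, π s a * g s a) := by
  rw [policyMatrix_eq_stepMatrix]
  simp only [pathProb]
  rw [sum_path_prod_mul_last (fun s a s' => π s a * P s a s')]
  simp [← Finset.mul_sum, hP.2]

/-! ### Row-stochastic matrices -/

/-- `Q` has nonnegative entries and rows of sum one. -/
def IsRowStochastic {S : Type*} [Fintype S] (Q : Matrix S S ℝ) : Prop :=
  (∀ s s', 0 ≤ Q s s') ∧ ∀ s, ∑ s', Q s s' = 1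

lemma isRowStochastic_policyMatrix {S A : Type*} [Fintype S] [Fintype A] {π : S → A → ℝ}
    (hπ : IsPolicy π) {P : S → A → S → ℝ} (hP : IsTransition P) :
    IsRowStochastic (policyMatrix π P) := by
  refine ⟨fun s s' => Finset.sum_nonneg fun a _ => mul_nonneg (hP.1 s a s') (hπ.1 s a),
    fun s => ?_⟩
  simp only [policyMatrix, of_apply]
  rw [Finset.sum_comm]
  simp [← Finset.sum_mul, hP.2, hπ.2]

lemma IsRowStochastic.mulVec_one {S : Type*} [Fintype S] {Q : Matrix S S ℝ}
    (hQ : IsRowStochastic Q) : Q *ᵥ 1 = 1 := by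
  ext s
  simp [mulVec, dotProduct, hQ.2]

lemma IsRowStochastic.abs_mulVec_le {S : Type*} [Fintype S] {Q : Matrix S S ℝ}
    (hQ : IsRowStochastic Q) {v : S → ℝ} {C : ℝ} (hv : ∀ s, |v s| ≤ C) (s : S) :
    |(Q *ᵥ v) s| ≤ C := by
  calc |(Q *ᵥ v) s| ≤ ∑ s', |Q s s' * v s'| := Finset.abs_sum_le_sum_abs _ _
    _ ≤ ∑ s', Q s s' * C := Finset.sum_le_sum fun s' _ => by
        rw [abs_mul, abs_of_nonneg (hQ.1 s s')]
        exact mul_le_mul_of_nonneg_left (hv s') (hQ.1 s s')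
    _ = C := by rw [← Finset.sum_mul, hQ.2, one_mul]

lemma IsRowStochastic.abs_pow_mulVec_le {S : Type*} [Fintype S] [DecidableEq S]
    {Q : Matrix S S ℝ} (hQ : IsRowStochastic Q) {v : S → ℝ} {C : ℝ} (hv : ∀ s, |v s| ≤ C) (n : ℕ)
    (s : S) : |((Q ^ n) *ᵥ v) s| ≤ C := by
  induction n generalizing s with
  | zero => simpa using hv s
  | succ n ih =>
    rw [pow_succ', ← mulVec_mulVec]
    exact hQ.abs_mulVec_le ih s

/-- A kernel vector satisfies `v = γ • Q *ᵥ v`; at a state where `|v|` is largest this forces `|v| ≤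
γ |v|`, so `v = 0`. -/
lemma IsRowStochastic.isUnit_det {S : Type*} [Fintype S] [DecidableEq S] {Q : Matrix S S ℝ}
    (hQ : IsRowStochastic Q) {γ : ℝ} (hγ0 : 0 ≤ γ) (hγ1 : γ < 1) : IsUnit (1 - γ • Q).det := by
  rw [isUnit_iff_ne_zero]
  intro h
  obtain ⟨v, hv, hv0⟩ := exists_mulVec_eq_zero_iff.2 h
  apply hv
  rw [sub_mulVec, one_mulVec, smul_mulVec, sub_eq_zero] at hv0
  rcases isEmpty_or_nonempty S with hS | hS
  · exact Subsingleton.elim _ _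
  obtain ⟨s₀, hs₀⟩ := Finite.exists_max fun s => |v s|
  have h1 : |v s₀| ≤ γ * |v s₀| := by
    conv_lhs => rw [hv0]
    rw [Pi.smul_apply, smul_eq_mul, abs_mul, abs_of_nonneg hγ0]
    exact mul_le_mul_of_nonneg_left (hQ.abs_mulVec_le hs₀ s₀) hγ0
  have h2 : |v s₀| ≤ 0 := by nlinarith [abs_nonneg (v s₀)]
  ext s
  exact abs_nonpos_iff.1 ((hs₀ s).trans h2)

/-- A function defined by a discounted sum of the powers of `Q` satisfies the Bellman equation. -/
lemma IsRowStochastic.bellman_tsum {S : Type*} [Fintype S] [DecidableEq S] {Q : Matrix S S ℝ}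
    (hQ : IsRowStochastic Q) {γ : ℝ} (hγ0 : 0 ≤ γ) (hγ1 : γ < 1) (r V : S → ℝ)
    (hV : ∀ s, V s = ∑' i : ℕ, γ ^ i * ((Q ^ i) *ᵥ r) s) :
    (1 - γ • Q) *ᵥ V = r := by
  have hC : ∀ s, |r s| ≤ ∑ s, |r s| := fun s =>
    Finset.single_le_sum (f := fun s => |r s|) (fun _ _ => abs_nonneg _) (Finset.mem_univ s)
  have hs : ∀ s, Summable fun i : ℕ => γ ^ i * ((Q ^ i) *ᵥ r) s := fun s => by
    refine Summable.of_norm_bounded ((summable_geometric_of_lt_one hγ0 hγ1).mul_right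
      (∑ s, |r s|)) fun i => ?_
    rw [Real.norm_eq_abs, abs_mul, abs_of_nonneg (pow_nonneg hγ0 i)]
    exact mul_le_mul_of_nonneg_left (hQ.abs_pow_mulVec_le hC i s) (pow_nonneg hγ0 i)
  rw [sub_mulVec, one_mulVec, smul_mulVec, sub_eq_iff_eq_add]
  ext s
  rw [hV, (hs s).tsum_eq_zero_add]
  simp only [pow_zero, one_mulVec, one_mul, Pi.add_apply, Pi.smul_apply, smul_eq_mul]
  congr 1
  have : (Q *ᵥ V) s = ∑' i : ℕ, ∑ s', Q s s' * (γ ^ i * ((Q ^ i) *ᵥ r) s') := by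
    rw [Summable.tsum_finsetSum fun s' _ => (hs s').mul_left _]
    refine Finset.sum_congr rfl fun s' _ => ?_
    rw [tsum_mul_left, hV]
  rw [this, ← tsum_mul_left]
  refine tsum_congr fun i => ?_
  rw [pow_succ', pow_succ', ← mulVec_mulVec, mulVec, dotProduct, mul_assoc, Finset.mul_sum]
  congr 1
  refine Finset.sum_congr rfl fun s' _ => ?_
  ring

/-! ### Irreducible chains -/

lemma IsStationaryDist.vecMul_pow {S : Type*} [Fintype S] [DecidableEq S] {Q : Matrix S S ℝ}
    {μ : S → ℝ} (h : IsStationaryDist Q μ) (n : ℕ) : μ ᵥ* Q ^ n = μ := by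
  induction n with
  | zero => simp
  | succ n ih => rw [pow_succ, ← vecMul_vecMul, ih, h.2.2]

lemma IsStationaryDist.pos {S : Type*} [Fintype S] [DecidableEq S] {Q : Matrix S S ℝ}
    (hQ : ∀ s s', 0 ≤ Q s s') (hirr : IsIrreducibleChain Q) {μ : S → ℝ}
    (h : IsStationaryDist Q μ) (s : S) : 0 < μ s := by
  obtain ⟨s₀, hs₀⟩ : ∃ s₀, μ s₀ ≠ 0 := by
    by_contra! hc
    simpa [hc] using h.2.1
  obtain ⟨n, hn⟩ := hirr s₀ s
  rw [← h.vecMul_pow n]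
  exact Finset.sum_pos' (fun s' _ => mul_nonneg (h.1 s') (pow_apply_nonneg hQ n s' s))
    ⟨s₀, Finset.mem_univ _, mul_pos ((h.1 s₀).lt_of_ne' hs₀) hn⟩

/-- By induction `c ^ n * Q ^ n ≤ R ^ n` entrywise, so positive entries of powers persist. -/
lemma IsIrreducibleChain.of_mul_le {S : Type*} [Fintype S] [DecidableEq S] {Q R : Matrix S S ℝ}
    (hQ : ∀ s s', 0 ≤ Q s s') (hirr : IsIrreducibleChain Q) {c : ℝ} (hc : 0 < c)
    (h : ∀ s s', c * Q s s' ≤ R s s') : IsIrreducibleChain R := by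
  have hR : ∀ s s', 0 ≤ R s s' := fun s s' => (mul_nonneg hc.le (hQ s s')).trans (h s s')
  have key : ∀ n s s', c ^ n * (Q ^ n) s s' ≤ (R ^ n) s s' := by
    intro n
    induction n with
    | zero => simp
    | succ n ih =>
      intro s s'
      rw [pow_succ' Q, pow_succ' R, mul_apply, mul_apply, Finset.mul_sum]
      refine Finset.sum_le_sum fun x _ => ?_
      calc c ^ (n + 1) * (Q s x * (Q ^ n) x s') = (c * Q s x) * (c ^ n * (Q ^ n) x s') := by ring
        _ ≤ _ := mul_le_mul (h s x) (ih x s')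
          (mul_nonneg (pow_nonneg hc.le n) (pow_apply_nonneg hQ n x s')) (hR s x)
  intro s s'
  obtain ⟨n, hn⟩ := hirr s s'
  exact ⟨n, (mul_pos (pow_pos hc n) hn).trans_le (key n s s')⟩

/-! ### Gaussian shifts -/

/-- Writing the shift as a multiple of the variance keeps the formula valid for the Dirac mass at `v
= 0`. -/
lemma gaussianReal_shift_eq_withDensity (m c : ℝ) (v : ℝ≥0) :
    gaussianReal (m + c * v) v =
      (gaussianReal m v).withDensity
        fun x => ENNReal.ofReal (Real.exp (c * (x - m) - c ^ 2 * v / 2)) := by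
  by_cases hv : v = 0
  · subst hv
    simp [dirac_withDensity]
  · rw [gaussianReal_of_var_ne_zero _ hv, gaussianReal_of_var_ne_zero _ hv,
      ← withDensity_mul _ (measurable_gaussianPDF _ _) (by fun_prop)]
    congr 1
    ext x
    have hv' : (v : ℝ) ≠ 0 := by exact_mod_cast hv
    rw [Pi.mul_apply, gaussianPDF, gaussianPDF, ← ENNReal.ofReal_mul (gaussianPDFReal_nonneg _ _ _),
      gaussianPDFReal, gaussianPDFReal, mul_assoc (√(2 * Real.pi * v))⁻¹, ← Real.exp_add]
    congr 3
    field_simp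
    ring

lemma integrable_exp_shift (m c d : ℝ) (v : ℝ≥0) :
    Integrable (fun x => Real.exp (c * (x - m) - d)) (gaussianReal m v) := by
  have h := (integrable_exp_mul_gaussianReal (μ := m) (v := v) c).mul_const (Real.exp (-(c * m) - d))
  refine h.congr (Filter.Eventually.of_forall fun x => ?_)
  simp only
  rw [← Real.exp_add]
  congr 1
  ring

lemma integral_exp_shift (m c d : ℝ) (v : ℝ≥0) :
    ∫ x, Real.exp (c * (x - m) - d) ∂gaussianReal m v = Real.exp (c ^ 2 * v / 2 - d) := by
  have h : ∀ x, Real.exp (c * (x - m) - d) = Real.exp (c * x) * Real.exp (-(c * m) - d) := by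
    intro x
    rw [← Real.exp_add]
    congr 1
    ring
  simp_rw [h]
  rw [integral_mul_const]
  have := congrFun (mgf_fun_id_gaussianReal (μ := m) (v := v)) c
  rw [mgf] at this
  rw [this, ← Real.exp_add]
  congr 1
  ring

/-! ### Likelihood ratios of shifted product Gaussians -/

section ProductGaussian

variable {ι : Type*} [Fintype ι]

/-- The density of a product of Gaussians with means `m i + c i * v i` with respect to the one
with means `m i`. -/
noncomputable def gaussianRatio (m c : ι → ℝ) (v : ι → ℝ≥0) (x : ι → ℝ) : ℝ :=
  ∏ i, Real.exp (c i * (x i - m i) - c i ^ 2 * v i / 2)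

lemma gaussianRatio_pos (m c : ι → ℝ) (v : ι → ℝ≥0) (x : ι → ℝ) : 0 < gaussianRatio m c v x :=
  Finset.prod_pos fun _ _ => Real.exp_pos _

lemma measurable_gaussianRatio (m c : ι → ℝ) (v : ι → ℝ≥0) :
    Measurable (gaussianRatio m c v) := by
  unfold gaussianRatio
  fun_prop

lemma integrable_gaussianRatio (m c : ι → ℝ) (v : ι → ℝ≥0) :
    Integrable (gaussianRatio m c v) (Measure.pi fun i => gaussianReal (m i) (v i)) :=
  Integrable.fintype_prod fun _ => integrable_exp_shift _ _ _ _

lemma integral_gaussianRatio (m c : ι → ℝ) (v : ι → ℝ≥0) :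
    ∫ x, gaussianRatio m c v x ∂(Measure.pi fun i => gaussianReal (m i) (v i)) = 1 := by
  unfold gaussianRatio
  rw [integral_fintype_prod_eq_prod fun i y => Real.exp (c i * (y - m i) - c i ^ 2 * v i / 2)]
  simp [integral_exp_shift]

lemma gaussianRatio_sq (m c : ι → ℝ) (v : ι → ℝ≥0) (x : ι → ℝ) :
    gaussianRatio m c v x ^ 2 = ∏ i, Real.exp (2 * c i * (x i - m i) - c i ^ 2 * v i) := by
  rw [gaussianRatio, ← Finset.prod_pow]
  refine Finset.prod_congr rfl fun i _ => ?_
  rw [← Real.exp_nat_mul]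
  congr 1
  push_cast
  ring

/-- Square integrability of the density makes every function that is square integrable at the
original means integrable at the shifted ones. -/
lemma memLp_gaussianRatio (m c : ι → ℝ) (v : ι → ℝ≥0) :
    MemLp (gaussianRatio m c v) 2 (Measure.pi fun i => gaussianReal (m i) (v i)) := by
  rw [memLp_two_iff_integrable_sq (measurable_gaussianRatio m c v).aestronglyMeasurable]
  simp_rw [gaussianRatio_sq]
  exact Integrable.fintype_prod
    (f := fun i y => Real.exp (2 * c i * (y - m i) - c i ^ 2 * v i))
    fun _ => integrable_exp_shift _ _ _ _

lemma integral_gaussianRatio_sq (m c : ι → ℝ) (v : ι → ℝ≥0) :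
    ∫ x, gaussianRatio m c v x ^ 2 ∂(Measure.pi fun i => gaussianReal (m i) (v i)) =
      ∏ i, Real.exp (c i ^ 2 * v i) := by
  simp_rw [gaussianRatio_sq]
  rw [integral_fintype_prod_eq_prod fun i y => Real.exp (2 * c i * (y - m i) - c i ^ 2 * v i)]
  refine Finset.prod_congr rfl fun i _ => ?_
  rw [integral_exp_shift]
  congr 1
  ring

/-- A product measure is determined by its values on boxes, where both the indicator and the density
factor over the coordinates. -/
lemma pi_gaussianReal_shift_eq_withDensity (m c : ι → ℝ) (v : ι → ℝ≥0) :
    (Measure.pi fun i => gaussianReal (m i + c i * v i) (v i)) =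
      (Measure.pi fun i => gaussianReal (m i) (v i)).withDensity
        fun x => ENNReal.ofReal (gaussianRatio m c v x) := by
  refine Measure.pi_eq fun s hs => ?_
  rw [withDensity_apply _ (MeasurableSet.univ_pi hs),
    ← ofReal_integral_eq_lintegral_ofReal (integrable_gaussianRatio m c v).integrableOn
      (Filter.Eventually.of_forall fun x => (gaussianRatio_pos m c v x).le),
    ← integral_indicator (MeasurableSet.univ_pi hs)]
  have h : ∀ x, (Set.univ.pi s).indicator (gaussianRatio m c v) x =
      ∏ i, (s i).indicator (fun y => Real.exp (c i * (y - m i) - c i ^ 2 * v i / 2)) (x i) := by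
    intro x
    by_cases hx : x ∈ Set.univ.pi s
    · rw [Set.indicator_of_mem hx]
      exact Finset.prod_congr rfl fun i _ => by rw [Set.indicator_of_mem (hx i trivial)]
    · rw [Set.indicator_of_notMem hx]
      simp only [Set.mem_pi, Set.mem_univ, true_implies, not_forall] at hx
      obtain ⟨i, hi⟩ := hx
      exact (Finset.prod_eq_zero (Finset.mem_univ i) (Set.indicator_of_notMem hi _)).symm
  simp_rw [h]
  rw [integral_fintype_prod_eq_prod fun i =>
      (s i).indicator (fun y => Real.exp (c i * (y - m i) - c i ^ 2 * v i / 2)),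
    ENNReal.ofReal_prod_of_nonneg fun i _ =>
      integral_nonneg fun y => Set.indicator_nonneg (fun _ _ => (Real.exp_pos _).le) y]
  refine Finset.prod_congr rfl fun i _ => ?_
  rw [integral_indicator (hs i), gaussianReal_shift_eq_withDensity, withDensity_apply _ (hs i),
    ← ofReal_integral_eq_lintegral_ofReal (integrable_exp_shift _ _ _ _).integrableOn
      (Filter.Eventually.of_forall fun x => (Real.exp_pos _).le)]

lemma integrable_shift {m : ι → ℝ} {v : ι → ℝ≥0} {X : (ι → ℝ) → ℝ}
    (hX : MemLp X 2 (Measure.pi fun i => gaussianReal (m i) (v i))) (c : ι → ℝ) :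
    Integrable X (Measure.pi fun i => gaussianReal (m i + c i * v i) (v i)) := by
  rw [pi_gaussianReal_shift_eq_withDensity, integrable_withDensity_iff_integrable_smul'
    (measurable_gaussianRatio m c v).ennreal_ofReal (by simp)]
  simp_rw [ENNReal.toReal_ofReal (gaussianRatio_pos m c v _).le, smul_eq_mul]
  exact (memLp_gaussianRatio m c v).integrable_mul hX

lemma integral_shift (m : ι → ℝ) (v : ι → ℝ≥0) (X : (ι → ℝ) → ℝ) (c : ι → ℝ) :
    ∫ x, X x ∂(Measure.pi fun i => gaussianReal (m i + c i * v i) (v i)) =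
      ∫ x, gaussianRatio m c v x * X x ∂(Measure.pi fun i => gaussianReal (m i) (v i)) := by
  rw [pi_gaussianReal_shift_eq_withDensity, integral_withDensity_eq_integral_toReal_smul
    (measurable_gaussianRatio m c v).ennreal_ofReal (by simp)]
  simp_rw [ENNReal.toReal_ofReal (gaussianRatio_pos m c v _).le, smul_eq_mul]

/-- The integral of `((X - e) - κ (ρ Λ - 1))²` is nonnegative, where `Λ` is the density of a
shifted product of Gaussians. -/
lemma shift_quadratic_nonneg {m : ι → ℝ} {v : ι → ℝ≥0} {X : (ι → ℝ) → ℝ}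
    (hX : MemLp X 2 (Measure.pi fun i => gaussianReal (m i) (v i))) (c : ι → ℝ) (e ρ κ : ℝ) :
    0 ≤ (∫ x, X x ^ 2 ∂(Measure.pi fun i => gaussianReal (m i) (v i)))
      - 2 * e * (∫ x, X x ∂(Measure.pi fun i => gaussianReal (m i) (v i))) + e ^ 2
      - 2 * κ * (ρ * (∫ x, X x ∂(Measure.pi fun i => gaussianReal (m i + c i * v i) (v i)))
        - (∫ x, X x ∂(Measure.pi fun i => gaussianReal (m i) (v i))) - e * ρ + e)
      + κ ^ 2 * (ρ ^ 2 * ∏ i, Real.exp (c i ^ 2 * v i) - 2 * ρ + 1) := by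
  set G := Measure.pi fun i => gaussianReal (m i) (v i)
  have h2 := memLp_gaussianRatio m c v
  have i1 : Integrable X G := hX.integrable (by norm_num)
  have i2 : Integrable (fun x => X x ^ 2) G := hX.integrable_sq
  have i3 := integrable_gaussianRatio m c v
  have i4 : Integrable (fun x => gaussianRatio m c v x * X x) G := h2.integrable_mul hX
  have i5 : Integrable (fun x => gaussianRatio m c v x ^ 2) G := h2.integrable_sq
  have key : 0 ≤ ∫ x, ((X x - e) - κ * (ρ * gaussianRatio m c v x - 1)) ^ 2 ∂G :=
    integral_nonneg fun x => sq_nonneg _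
  have expand : ∀ x, ((X x - e) - κ * (ρ * gaussianRatio m c v x - 1)) ^ 2 =
      X x ^ 2 + (2 * κ - 2 * e) * X x + (-(2 * κ * ρ)) * (gaussianRatio m c v x * X x) +
        (2 * κ * ρ * e - 2 * κ ^ 2 * ρ) * gaussianRatio m c v x +
        (κ ^ 2 * ρ ^ 2) * gaussianRatio m c v x ^ 2 + (e - κ) ^ 2 := fun x => by ring
  simp_rw [expand] at key
  have j1 := i2.fun_add (i1.const_mul (2 * κ - 2 * e))
  have j2 := j1.fun_add (i4.const_mul (-(2 * κ * ρ)))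
  have j3 := j2.fun_add (i3.const_mul (2 * κ * ρ * e - 2 * κ ^ 2 * ρ))
  have j4 := j3.fun_add (i5.const_mul (κ ^ 2 * ρ ^ 2))
  rw [integral_add j4 (integrable_const _), integral_add j3 (i5.const_mul _),
    integral_add j2 (i3.const_mul _), integral_add j1 (i4.const_mul _),
    integral_add i2 (i1.const_mul _)] at key
  simp only [integral_const_mul, integral_gaussianRatio, integral_gaussianRatio_sq,
    integral_const, G, ← integral_shift] at key
  simp only [probReal_univ, one_smul] at key
  linarith

end ProductGaussian

/-! ### Expectations under the law of a trajectory -/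

lemma pathProb_nonneg {S A : Type*} [Fintype S] [Fintype A] {T : ℕ} {π : S → A → ℝ} (hπ : IsPolicy π) {ν : S → ℝ} (hν : ∀ s, 0 ≤ ν s)
    {P : S → A → S → ℝ} (hP : IsTransition P) (s : Fin (T + 1) → S) (a : Fin T → A) :
    0 ≤ pathProb π ν P s a :=
  mul_nonneg (hν _) (Finset.prod_nonneg fun _ _ => mul_nonneg (hπ.1 _ _) (hP.1 _ _ _))

section Trajectory

set_option linter.unusedSectionVars false

variable {S A : Type*} [Fintype S] [Fintype A] [MeasurableSpace S] [MeasurableSpace A]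
  [MeasurableSingletonClass S] [MeasurableSingletonClass A] {T : ℕ}

/-- The law of the rewards given the states and actions. -/
noncomputable def rewardLaw (σ2 : S → A → ℝ≥0) (r : S → A → ℝ) (s : Fin (T + 1) → S)
    (a : Fin T → A) : Measure (Fin T → ℝ) :=
  Measure.pi fun t : Fin T => gaussianReal (r (s t.castSucc) (a t)) (σ2 (s t.castSucc) (a t))

instance (σ2 : S → A → ℝ≥0) (r : S → A → ℝ) (s : Fin (T + 1) → S) (a : Fin T → A) :
    IsProbabilityMeasure (rewardLaw σ2 r s a) := by
  unfold rewardLaw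
  infer_instance

lemma measurableEmbedding_path (s : Fin (T + 1) → S) (a : Fin T → A) :
    MeasurableEmbedding fun x : Fin T → ℝ => ((s, a, x) : Trajectory S A T) :=
  (measurableEmbedding_prodMk_left s).comp (measurableEmbedding_prodMk_left a)

lemma trajLaw_eq_sum_map (π : S → A → ℝ) (σ2 : S → A → ℝ≥0) (ν : S → ℝ) (θ : MDPParam S A) :
    trajLaw T π σ2 ν θ = ∑ s : Fin (T + 1) → S, ∑ a : Fin T → A,
      ENNReal.ofReal (pathProb π ν θ.1 s a) •
        (rewardLaw σ2 θ.2 s a).map fun x => ((s, a, x) : Trajectory S A T) := by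
  unfold trajLaw rewardLaw
  refine Finset.sum_congr rfl fun s _ => Finset.sum_congr rfl fun a _ => ?_
  rw [Measure.dirac_prod, Measure.dirac_prod,
    Measure.map_map measurable_prodMk_left measurable_prodMk_left]
  rfl

/-- Transfers integrability from the mixture to each path of positive probability; nothing can be
said on null paths. -/
lemma map_rewardLaw_le_smul_trajLaw {π : S → A → ℝ} {σ2 : S → A → ℝ≥0} {ν : S → ℝ}
    {θ : MDPParam S A} {s : Fin (T + 1) → S} {a : Fin T → A} (h : 0 < pathProb π ν θ.1 s a) :
    (rewardLaw σ2 θ.2 s a).map (fun x => ((s, a, x) : Trajectory S A T)) ≤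
      (ENNReal.ofReal (pathProb π ν θ.1 s a))⁻¹ • trajLaw T π σ2 ν θ := by
  set p := ENNReal.ofReal (pathProb π ν θ.1 s a) with hp
  have hp0 : p ≠ 0 := by simpa [hp] using h
  have hle : p • (rewardLaw σ2 θ.2 s a).map (fun x => ((s, a, x) : Trajectory S A T)) ≤
      trajLaw T π σ2 ν θ := by
    rw [trajLaw_eq_sum_map]
    refine le_trans ?_ (Finset.single_le_sum (f := fun s => ∑ a : Fin T → A,
      ENNReal.ofReal (pathProb π ν θ.1 s a) •
        (rewardLaw σ2 θ.2 s a).map fun x => ((s, a, x) : Trajectory S A T))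
      (fun _ _ => Measure.zero_le _) (Finset.mem_univ s))
    exact Finset.single_le_sum (f := fun a => ENNReal.ofReal (pathProb π ν θ.1 s a) •
        (rewardLaw σ2 θ.2 s a).map fun x => ((s, a, x) : Trajectory S A T))
      (fun _ _ => Measure.zero_le _) (Finset.mem_univ a)
  calc (rewardLaw σ2 θ.2 s a).map (fun x => ((s, a, x) : Trajectory S A T))
      = p⁻¹ • p • (rewardLaw σ2 θ.2 s a).map (fun x => ((s, a, x) : Trajectory S A T)) := by
        rw [smul_smul, ENNReal.inv_mul_cancel hp0 ENNReal.ofReal_ne_top, one_smul]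
    _ ≤ p⁻¹ • trajLaw T π σ2 ν θ := by gcongr

lemma memLp_rewardLaw_of_trajLaw {E : Type*} [NormedAddCommGroup E] {π : S → A → ℝ}
    {σ2 : S → A → ℝ≥0} {ν : S → ℝ} {θ : MDPParam S A} {F : Trajectory S A T → E} {q : ℝ≥0∞}
    (hF : MemLp F q (trajLaw T π σ2 ν θ)) {s : Fin (T + 1) → S} {a : Fin T → A}
    (h : 0 < pathProb π ν θ.1 s a) : MemLp (fun x => F (s, a, x)) q (rewardLaw σ2 θ.2 s a) :=
  (measurableEmbedding_path s a).memLp_map_measure_iff.1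
    (hF.of_measure_le_smul (by simpa using h) (map_rewardLaw_le_smul_trajLaw h))

lemma integrable_trajLaw {E : Type*} [NormedAddCommGroup E] {π : S → A → ℝ}
    {σ2 : S → A → ℝ≥0} {ν : S → ℝ} {θ : MDPParam S A} {F : Trajectory S A T → E}
    (hF : ∀ s a, 0 < pathProb π ν θ.1 s a →
      Integrable (fun x => F (s, a, x)) (rewardLaw σ2 θ.2 s a)) :
    Integrable F (trajLaw T π σ2 ν θ) := by
  rw [trajLaw_eq_sum_map]
  refine integrable_finsetSum_measure.2 fun s _ => integrable_finsetSum_measure.2 fun a _ => ?_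
  by_cases h : 0 < pathProb π ν θ.1 s a
  · exact ((measurableEmbedding_path s a).integrable_map_iff.2 (hF s a h)).smul_measure
      ENNReal.ofReal_ne_top
  · simp [ENNReal.ofReal_of_nonpos (not_lt.1 h)]

lemma integral_trajLaw {E : Type*} [NormedAddCommGroup E] [NormedSpace ℝ E] {π : S → A → ℝ}
    (hπ : IsPolicy π) {σ2 : S → A → ℝ≥0} {ν : S → ℝ} (hν : ∀ s, 0 ≤ ν s) {θ : MDPParam S A}
    (hθ : IsTransition θ.1) {F : Trajectory S A T → E} (hF : Integrable F (trajLaw T π σ2 ν θ)) :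
    ∫ τ, F τ ∂(trajLaw T π σ2 ν θ) = ∑ s, ∑ a,
      pathProb π ν θ.1 s a • ∫ x, F (s, a, x) ∂(rewardLaw σ2 θ.2 s a) := by
  rw [trajLaw_eq_sum_map] at hF ⊢
  have h1 := integrable_finsetSum_measure.1 hF
  rw [integral_finsetSum_measure h1]
  refine Finset.sum_congr rfl fun s hs => ?_
  rw [integral_finsetSum_measure (integrable_finsetSum_measure.1 (h1 s hs))]
  refine Finset.sum_congr rfl fun a _ => ?_
  rw [integral_smul_measure, (measurableEmbedding_path s a).integral_map,
    ENNReal.toReal_ofReal (pathProb_nonneg hπ hν hθ s a)]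

end Trajectory

/-! ### The total mass of the law of a trajectory -/

lemma IsRowStochastic.pow_mulVec_one {S : Type*} [Fintype S] [DecidableEq S] {Q : Matrix S S ℝ}
    (hQ : IsRowStochastic Q) (n : ℕ) : (Q ^ n) *ᵥ 1 = 1 := by
  induction n with
  | zero => simp
  | succ n ih => rw [pow_succ, ← mulVec_mulVec, hQ.mulVec_one, ih]

lemma sum_pathProb {S A : Type*} [Fintype S] [Fintype A] {π : S → A → ℝ}
    (hπ : IsPolicy π) {ν : S → ℝ} (hν : ∑ s, ν s = 1) {P : S → A → S → ℝ} (hP : IsTransition P)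
    (T : ℕ) : ∑ s : Fin (T + 1) → S, ∑ a : Fin T → A, pathProb π ν P s a = 1 := by
  classical
  simp only [pathProb]
  rw [sum_path_prod (fun s a s' => π s a * P s a s'), ← policyMatrix_eq_stepMatrix,
    (isRowStochastic_policyMatrix hπ hP).pow_mulVec_one, dotProduct_one, hν]

lemma isProbabilityMeasure_trajLaw {S A : Type*} [Fintype S] [Fintype A] [MeasurableSpace S]
    [MeasurableSpace A] (T : ℕ) {π : S → A → ℝ} (hπ : IsPolicy π) (σ2 : S → A → ℝ≥0) {ν : S → ℝ}
    (hν0 : ∀ s, 0 ≤ ν s) (hν : ∑ s, ν s = 1) {θ : MDPParam S A} (hθ : IsTransition θ.1) :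
    IsProbabilityMeasure (trajLaw T π σ2 ν θ) := by
  constructor
  have h := sum_pathProb hπ hν hθ T
  have hn := fun s a => pathProb_nonneg (T := T) hπ hν0 hθ s a
  simp only [trajLaw, Measure.coe_finsetSum, Finset.sum_apply, Measure.smul_apply,
    measure_univ, smul_eq_mul, mul_one]
  simp_rw [← ENNReal.ofReal_sum_of_nonneg fun a _ => hn _ a]
  rw [← ENNReal.ofReal_sum_of_nonneg fun s _ => Finset.sum_nonneg fun a _ => hn s a, h,
    ENNReal.ofReal_one]

/-! ### The value function -/

section Value

variable {S A : Type*} [Fintype S] [Fintype A] [DecidableEq S] [MeasurableSpace S]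
  [MeasurableSpace A] [MeasurableSingletonClass S] [MeasurableSingletonClass A]

lemma integral_reward_last {π : S → A → ℝ} (hπ : IsPolicy π) (σ2 : S → A → ℝ≥0) {ν : S → ℝ}
    (hν : ∀ s, 0 ≤ ν s) {θ : MDPParam S A} (hθ : IsTransition θ.1) (g : S → A → ℝ) (i : ℕ) :
    ∫ τ, g (τ.1 (Fin.last i).castSucc) (τ.2.1 (Fin.last i)) ∂(trajLaw (i + 1) π σ2 ν θ) =
      ν ⬝ᵥ (policyMatrix π θ.1 ^ i *ᵥ fun s => ∑ a, π s a * g s a) := by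
  rw [integral_trajLaw hπ hν hθ (integrable_trajLaw fun s a _ =>
    integrable_const (g (s (Fin.last i).castSucc) (a (Fin.last i)))),
    ← sum_pathProb_mul_last π hθ]
  simp

/-- From here on the value function is handled only through this linear system, not through its
series. -/
lemma valueFn_bellman {γ : ℝ} (hγ0 : 0 ≤ γ) (hγ1 : γ < 1) {π : S → A → ℝ} (hπ : IsPolicy π)
    (σ2 : S → A → ℝ≥0) {θ : MDPParam S A} (hθ : IsTransition θ.1) :
    (1 - γ • policyMatrix π θ.1) *ᵥ valueFn γ π σ2 θ = fun s => ∑ a, π s a * θ.2 s a := by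
  refine (isRowStochastic_policyMatrix hπ hθ).bellman_tsum hγ0 hγ1 _ _ fun s => ?_
  unfold valueFn
  refine tsum_congr fun i => ?_
  rw [integral_reward_last hπ σ2 (fun s' => ?_) hθ, single_one_dotProduct]
  by_cases h : s' = s
  · subst h; simp
  · simp [h]

lemma eq_valueFn_of_bellman {γ : ℝ} (hγ0 : 0 ≤ γ) (hγ1 : γ < 1) {π : S → A → ℝ}
    (hπ : IsPolicy π) (σ2 : S → A → ℝ≥0) {θ : MDPParam S A} (hθ : IsTransition θ.1) {V : S → ℝ}
    (hV : (1 - γ • policyMatrix π θ.1) *ᵥ V = fun s => ∑ a, π s a * θ.2 s a) :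
    V = valueFn γ π σ2 θ :=
  mulVec_injective_of_isUnit ((isUnit_iff_isUnit_det _).2
    ((isRowStochastic_policyMatrix hπ hθ).isUnit_det hγ0 hγ1))
    (hV.trans (valueFn_bellman hγ0 hγ1 hπ σ2 hθ).symm)

end Value

/-! ### The least favourable submodel -/

section Tilt

set_option linter.unusedSectionVars false

variable {S A : Type*} [Fintype S] [Fintype A]

/-- The variance of `u` under the transition law `P s a`. -/
def stepVar (P : S → A → S → ℝ) (u : S → ℝ) (s : S) (a : A) : ℝ :=
  ∑ s', P s a s' * (u s' - P s a ⬝ᵥ u) ^ 2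

/-- The relative change per unit of `ε` of the transition probability in `tiltParam`. -/
def tiltScore (P : S → A → S → ℝ) (c u : S → ℝ) (s : S) (a : A) (s' : S) : ℝ :=
  c s * (u s' - P s a ⬝ᵥ u)

/-- The parameter obtained from `θ` by moving it by `ε` in the direction given by `c` and `u`. -/
def tiltParam (σ2 : S → A → ℝ≥0) (c u : S → ℝ) (θ : MDPParam S A) (ε : ℝ) : MDPParam S A :=
  (fun s a s' => θ.1 s a s' * (1 + ε * tiltScore θ.1 c u s a s'),
    fun s a => θ.2 s a + ε * c s * σ2 s a)

/-- Centring `u` at its mean under `P s a` keeps the row sums of the tilted transitions equal to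
one. -/
lemma sum_mul_tiltScore {P : S → A → S → ℝ} (hP : IsTransition P) (c u : S → ℝ) (s : S) (a : A) :
    ∑ s', P s a s' * tiltScore P c u s a s' = 0 := by
  have : ∀ s', P s a s' * tiltScore P c u s a s' =
      c s * (P s a s' * u s') - c s * (P s a ⬝ᵥ u) * P s a s' := fun s' => by
    rw [tiltScore]; ring
  simp_rw [this]
  rw [Finset.sum_sub_distrib, ← Finset.mul_sum, ← Finset.mul_sum, hP.2]
  simp [dotProduct]

lemma sum_mul_tiltScore_sq (P : S → A → S → ℝ) (c u : S → ℝ) (s : S) (a : A) :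
    ∑ s', P s a s' * tiltScore P c u s a s' ^ 2 = c s ^ 2 * stepVar P u s a := by
  rw [stepVar, Finset.mul_sum]
  refine Finset.sum_congr rfl fun s' _ => ?_
  rw [tiltScore]
  ring

/-- Since the score is proportional to the centred `u`, one variance gives both its inner product
with `u` and, up to a factor `c s`, its second moment. This is the equality case of Cauchy–Schwarz,
and it makes the direction least favourable. -/
lemma sum_mul_tiltScore_mul {P : S → A → S → ℝ} (hP : IsTransition P) (c u : S → ℝ) (s : S)
    (a : A) : ∑ s', P s a s' * tiltScore P c u s a s' * u s' = c s * stepVar P u s a := by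
  have h : ∀ s', P s a s' * tiltScore P c u s a s' * u s' =
      c s * (P s a s' * (u s' - P s a ⬝ᵥ u) ^ 2) +
        (P s a ⬝ᵥ u) * (P s a s' * tiltScore P c u s a s') := fun s' => by
    rw [tiltScore]; ring
  simp_rw [h]
  rw [Finset.sum_add_distrib, ← Finset.mul_sum, ← Finset.mul_sum, sum_mul_tiltScore hP, stepVar]
  simp

lemma stepVar_eq {P : S → A → S → ℝ} (hP : IsTransition P) (u : S → ℝ) (s : S) (a : A) :
    stepVar P u s a = (∑ s', P s a s' * u s' ^ 2) - (P s a ⬝ᵥ u) ^ 2 := by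
  have h : ∀ s', P s a s' * (u s' - P s a ⬝ᵥ u) ^ 2 = P s a s' * u s' ^ 2 -
      2 * (P s a ⬝ᵥ u) * (P s a s' * u s') + (P s a ⬝ᵥ u) ^ 2 * P s a s' := fun s' => by ring
  simp_rw [stepVar, h]
  rw [Finset.sum_add_distrib, Finset.sum_sub_distrib, ← Finset.mul_sum, ← Finset.mul_sum, hP.2]
  change _ - 2 * (P s a ⬝ᵥ u) * (P s a ⬝ᵥ u) + _ = _
  ring

lemma tiltParam_zero (σ2 : S → A → ℝ≥0) (c u : S → ℝ) (θ : MDPParam S A) :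
    tiltParam σ2 c u θ 0 = θ := by
  simp [tiltParam]

lemma tiltParam_sub (σ2 : S → A → ℝ≥0) (c u : S → ℝ) (θ : MDPParam S A) (ε : ℝ) :
    tiltParam σ2 c u θ ε - θ = ε • ((fun s a s' => θ.1 s a s' * tiltScore θ.1 c u s a s',
      fun s a => c s * σ2 s a) : MDPParam S A) := by
  refine Prod.ext ?_ ?_
  · ext s a s'
    simp only [tiltParam, Prod.fst_sub, Prod.smul_fst, Pi.sub_apply, Pi.smul_apply, smul_eq_mul]
    ring
  · ext s a
    simp only [tiltParam, Prod.snd_sub, Prod.smul_snd, Pi.sub_apply, Pi.smul_apply, smul_eq_mul]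
    ring

lemma tendsto_tiltParam (σ2 : S → A → ℝ≥0) (c u : S → ℝ) (θ : MDPParam S A) :
    Filter.Tendsto (tiltParam σ2 c u θ) (𝓝 0) (𝓝 θ) := by
  have hc : Continuous (tiltParam σ2 c u θ) := by
    unfold tiltParam
    fun_prop
  simpa only [tiltParam_zero] using hc.tendsto 0

lemma eventually_abs_tiltScore_le (P : S → A → S → ℝ) (c u : S → ℝ) :
    ∀ᶠ ε in 𝓝 (0 : ℝ), ∀ s a s', |ε * tiltScore P c u s a s'| ≤ 1 / 2 := by
  refine Filter.eventually_all.2 fun s => Filter.eventually_all.2 fun a =>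
    Filter.eventually_all.2 fun s' => ?_
  have h : Filter.Tendsto (fun ε : ℝ => |ε * tiltScore P c u s a s'|) (𝓝 0) (𝓝 0) := by
    have hc : Continuous fun ε : ℝ => |ε * tiltScore P c u s a s'| := by fun_prop
    simpa using hc.tendsto 0
  exact h.eventually_le_const (by norm_num)

lemma isTransition_tiltParam (σ2 : S → A → ℝ≥0) (c u : S → ℝ) {θ : MDPParam S A}
    (hθ : IsTransition θ.1) {ε : ℝ}
    (hε : ∀ s a s', |ε * tiltScore θ.1 c u s a s'| ≤ 1 / 2) :
    IsTransition (tiltParam σ2 c u θ ε).1 := by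
  refine ⟨fun s a s' => mul_nonneg (hθ.1 s a s') ?_, fun s a => ?_⟩
  · linarith [(abs_le.1 (hε s a s')).1]
  · have h : ∀ s', (tiltParam σ2 c u θ ε).1 s a s' =
        θ.1 s a s' + ε * (θ.1 s a s' * tiltScore θ.1 c u s a s') := fun s' => by
      simp only [tiltParam]; ring
    simp_rw [h]
    rw [Finset.sum_add_distrib, ← Finset.mul_sum, hθ.2, sum_mul_tiltScore hθ]
    simp

/-- The tilt is multiplicative: for small `ε` each transition probability is at least half of the
original one, so irreducibility survives. -/
lemma eventually_tiltParam_mem [DecidableEq S] {π : S → A → ℝ} (hπ : IsPolicy π)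
    (σ2 : S → A → ℝ≥0) (c u : S → ℝ) {θ : MDPParam S A} (hθ : θ ∈ irreducibleModel π) :
    ∀ᶠ ε in 𝓝 (0 : ℝ), tiltParam σ2 c u θ ε ∈ irreducibleModel π := by
  filter_upwards [eventually_abs_tiltScore_le θ.1 c u] with ε hε
  refine ⟨isTransition_tiltParam σ2 c u hθ.1 hε, hθ.2.of_mul_le
    (isRowStochastic_policyMatrix hπ hθ.1).1 (c := 1 / 2) (by norm_num) fun s s' => ?_⟩
  simp only [policyMatrix, of_apply, Finset.mul_sum, tiltParam]
  refine Finset.sum_le_sum fun a _ => ?_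
  have h := (abs_le.1 (hε s a s')).1
  have h2 := mul_nonneg (hθ.1.1 s a s') (hπ.1 s a)
  nlinarith

lemma pathProb_tiltParam {T : ℕ} (π : S → A → ℝ) (ν : S → ℝ) (σ2 : S → A → ℝ≥0) (c u : S → ℝ)
    (θ : MDPParam S A) (ε : ℝ) (s : Fin (T + 1) → S) (a : Fin T → A) :
    pathProb π ν (tiltParam σ2 c u θ ε).1 s a = pathProb π ν θ.1 s a *
      ∏ t : Fin T, (1 + ε * tiltScore θ.1 c u (s t.castSucc) (a t) (s t.succ)) := by
  simp only [pathProb, tiltParam]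
  rw [mul_assoc, ← Finset.prod_mul_distrib]
  simp only [mul_assoc]

/-- The transition weights whose path sums are the second moments of the likelihood ratio of
`tiltParam`. -/
noncomputable def tiltKernel (π : S → A → ℝ) (σ2 : S → A → ℝ≥0) (P : S → A → S → ℝ) (c u : S → ℝ)
    (ε : ℝ) (s : S) (a : A) (s' : S) : ℝ :=
  π s a * P s a s' *
    ((1 + ε * tiltScore P c u s a s') ^ 2 * Real.exp ((ε * c s) ^ 2 * σ2 s a))

variable [MeasurableSpace S] [MeasurableSpace A] [MeasurableSingletonClass S]
  [MeasurableSingletonClass A]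

/-- The Hammersley–Chapman–Robbins inequality in quadratic form, for the law of a trajectory. -/
lemma variance_tilt_quadratic_nonneg [DecidableEq S] {T : ℕ} {π : S → A → ℝ} (hπ : IsPolicy π)
    {σ2 : S → A → ℝ≥0} {ν : S → ℝ} (hν0 : ∀ s, 0 ≤ ν s) (hν : ∑ s, ν s = 1) {θ : MDPParam S A}
    (hθ : IsTransition θ.1) (c u : S → ℝ) {ε : ℝ} (hε : IsTransition (tiltParam σ2 c u θ ε).1)
    {X : Trajectory S A T → ℝ} (hX : MemLp X 2 (trajLaw T π σ2 ν θ)) (κ : ℝ) :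
    0 ≤ variance X (trajLaw T π σ2 ν θ)
      - 2 * κ * ((∫ τ, X τ ∂(trajLaw T π σ2 ν (tiltParam σ2 c u θ ε)))
        - ∫ τ, X τ ∂(trajLaw T π σ2 ν θ))
      + κ ^ 2 * (ν ⬝ᵥ (stepMatrix (tiltKernel π σ2 θ.1 c u ε) ^ T *ᵥ 1) - 1) := by
  have := isProbabilityMeasure_trajLaw T hπ σ2 hν0 hν hθ
  have hint : Integrable X (trajLaw T π σ2 ν (tiltParam σ2 c u θ ε)) := by
    refine integrable_trajLaw fun s a hsa => ?_
    rw [pathProb_tiltParam] at hsa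
    -- The tilted path probability is a multiple of the original one, so no path gains support.
    have hpos : 0 < pathProb π ν θ.1 s a :=
      (pathProb_nonneg hπ hν0 hθ s a).lt_of_ne (left_ne_zero_of_mul hsa.ne').symm
    exact integrable_shift (memLp_rewardLaw_of_trajLaw hX hpos) fun t => ε * c (s t.castSucc)
  have e1 := integral_trajLaw hπ hν0 hε hint
  have e2 := integral_trajLaw hπ hν0 hθ (hX.integrable (by norm_num))
  have e3 := integral_trajLaw hπ hν0 hθ hX.integrable_sq
  have e4 : ν ⬝ᵥ (stepMatrix (tiltKernel π σ2 θ.1 c u ε) ^ T *ᵥ 1) =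
      ∑ s : Fin (T + 1) → S, ∑ a : Fin T → A, pathProb π ν θ.1 s a *
        ((∏ t : Fin T, (1 + ε * tiltScore θ.1 c u (s t.castSucc) (a t) (s t.succ))) ^ 2 *
          ∏ t : Fin T, Real.exp ((ε * c (s t.castSucc)) ^ 2 * σ2 (s t.castSucc) (a t))) := by
    rw [← sum_path_prod]
    refine Finset.sum_congr rfl fun s _ => Finset.sum_congr rfl fun a _ => ?_
    simp only [tiltKernel, pathProb]
    rw [mul_assoc, ← Finset.prod_pow, ← Finset.prod_mul_distrib, ← Finset.prod_mul_distrib]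
  have e5 := sum_pathProb hπ hν hθ T
  have e6 := sum_pathProb hπ hν hε T
  simp only [pathProb_tiltParam] at e1 e6
  rw [variance_eq_sub hX]
  simp only [Pi.pow_apply]
  set e := ∫ τ, X τ ∂(trajLaw T π σ2 ν θ) with he
  -- The quadratic inequality is applied on each path with `e` the global mean, not the conditional
  -- one; the weighted sum is then the variance expression for the whole law.
  have key : 0 ≤ ∑ s : Fin (T + 1) → S, ∑ a : Fin T → A, pathProb π ν θ.1 s a *
      ((∫ x, X (s, a, x) ^ 2 ∂(rewardLaw σ2 θ.2 s a))
      - 2 * e * (∫ x, X (s, a, x) ∂(rewardLaw σ2 θ.2 s a)) + e ^ 2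
      - 2 * κ * ((∏ t : Fin T, (1 + ε * tiltScore θ.1 c u (s t.castSucc) (a t) (s t.succ))) *
          (∫ x, X (s, a, x) ∂(rewardLaw σ2 (tiltParam σ2 c u θ ε).2 s a))
        - (∫ x, X (s, a, x) ∂(rewardLaw σ2 θ.2 s a))
        - e * (∏ t : Fin T, (1 + ε * tiltScore θ.1 c u (s t.castSucc) (a t) (s t.succ))) + e)
      + κ ^ 2 * ((∏ t : Fin T,
          (1 + ε * tiltScore θ.1 c u (s t.castSucc) (a t) (s t.succ))) ^ 2 *
          (∏ t : Fin T, Real.exp ((ε * c (s t.castSucc)) ^ 2 * σ2 (s t.castSucc) (a t)))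
        - 2 * (∏ t : Fin T, (1 + ε * tiltScore θ.1 c u (s t.castSucc) (a t) (s t.succ)))
        + 1)) := by
    refine Finset.sum_nonneg fun s _ => Finset.sum_nonneg fun a _ => ?_
    rcases (pathProb_nonneg hπ hν0 hθ s a).eq_or_lt with h | h
    · rw [← h, zero_mul]
    · exact mul_nonneg h.le (shift_quadratic_nonneg (memLp_rewardLaw_of_trajLaw hX h)
        (fun t => ε * c (s t.castSucc)) e _ κ)
  have expand : ∀ p I2 I1 R J L : ℝ, p * (I2 - 2 * e * I1 + e ^ 2 -
      2 * κ * (R * J - I1 - e * R + e) + κ ^ 2 * (R ^ 2 * L - 2 * R + 1)) =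
      p * I2 + (2 * κ - 2 * e) * (p * I1) + (e ^ 2 - 2 * κ * e + κ ^ 2) * p -
        2 * κ * (p * R * J) + (2 * κ * e - 2 * κ ^ 2) * (p * R) +
        κ ^ 2 * (p * (R ^ 2 * L)) := fun p I2 I1 R J L => by ring
  simp only [expand, Finset.sum_add_distrib, Finset.sum_sub_distrib, ← Finset.mul_sum] at key
  simp only [smul_eq_mul] at e1 e2 e3
  rw [← e3, ← e2, ← e1, ← e4, e5, e6] at key
  linarith

end Tilt

/-! ### Second-order expansion of the second moments -/

/-- A derivative at zero in the variable `ε ^ 2`. -/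
lemma tendsto_exp_mul_sub_one_div_sq (α β : ℝ) :
    Filter.Tendsto (fun ε : ℝ => (ε ^ 2)⁻¹ * (Real.exp (ε ^ 2 * α) * (1 + ε ^ 2 * β) - 1))
      (𝓝[≠] 0) (𝓝 (α + β)) := by
  have hd : HasDerivAt (fun x : ℝ => Real.exp (x * α) * (1 + x * β)) (α + β) 0 := by
    have h1 : HasDerivAt (fun x : ℝ => Real.exp (x * α)) (Real.exp (0 * α) * (1 * α)) 0 :=
      ((hasDerivAt_id (0 : ℝ)).mul_const α).exp
    have h2 : HasDerivAt (fun x : ℝ => 1 + x * β) (1 * β) 0 :=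
      ((hasDerivAt_id (0 : ℝ)).mul_const β).const_add 1
    refine (h1.mul h2).congr_deriv ?_
    simp
  have hs : Filter.Tendsto (fun ε : ℝ => ε ^ 2) (𝓝[≠] 0) (𝓝[≠] 0) := by
    refine tendsto_nhdsWithin_iff.2 ⟨?_, ?_⟩
    · have : Filter.Tendsto (fun ε : ℝ => ε ^ 2) (𝓝 0) (𝓝 (0 ^ 2)) :=
        (continuous_pow 2).tendsto 0
      simpa using this.mono_left nhdsWithin_le_nhds
    · filter_upwards [self_mem_nhdsWithin] with ε hε
      exact pow_ne_zero 2 hε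
  refine (hd.tendsto_slope_zero.comp hs).congr fun ε => ?_
  simp

lemma tendsto_mulVec {S ι : Type*} [Fintype S] {l : Filter ι} {M : ι → Matrix S S ℝ}
    {v : ι → S → ℝ} {M₀ : Matrix S S ℝ} {v₀ : S → ℝ} (hM : Filter.Tendsto M l (𝓝 M₀))
    (hv : Filter.Tendsto v l (𝓝 v₀)) : Filter.Tendsto (fun i => M i *ᵥ v i) l (𝓝 (M₀ *ᵥ v₀)) :=
  ((Continuous.matrix_mulVec continuous_fst continuous_snd).tendsto (M₀, v₀)).comp
    (hM.prodMk_nhds hv)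

/-- Telescoping: `K ^ (T + 1) *ᵥ 1 - 1 = (K ^ T *ᵥ 1 - 1) + K ^ T *ᵥ (K *ᵥ 1 - 1)`. -/
lemma tendsto_pow_mulVec_one_sub_one {S : Type*} [Fintype S] [DecidableEq S] {l : Filter ℝ}
    {K : ℝ → Matrix S S ℝ} {Q : Matrix S S ℝ} {b : S → ℝ} (hK : Filter.Tendsto K l (𝓝 Q))
    (hb : Filter.Tendsto (fun ε : ℝ => (ε ^ 2)⁻¹ • (K ε *ᵥ 1 - 1)) l (𝓝 b)) (T : ℕ) :
    Filter.Tendsto (fun ε : ℝ => (ε ^ 2)⁻¹ • ((K ε ^ T) *ᵥ 1 - 1)) l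
      (𝓝 (∑ t ∈ Finset.range T, (Q ^ t) *ᵥ b)) := by
  induction T with
  | zero => simpa using tendsto_const_nhds
  | succ T ih =>
    rw [Finset.sum_range_succ]
    have hp : Filter.Tendsto (fun ε => K ε ^ T) l (𝓝 (Q ^ T)) :=
      ((continuous_id.pow T).tendsto Q).comp hK
    refine (ih.add (tendsto_mulVec hp hb)).congr fun ε => ?_
    rw [pow_succ (K ε), ← mulVec_mulVec, mulVec_smul, ← smul_add, mulVec_sub]
    congr 1
    abel

section TiltLimit

variable {S A : Type*} [Fintype S] [Fintype A]

/-- The sum over actions of the reward variance and the variance of `u` after one step. -/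
def infoVar (π : S → A → ℝ) (σ2 : S → A → ℝ≥0) (P : S → A → S → ℝ) (u : S → ℝ) (s : S) : ℝ :=
  ∑ a, π s a * (σ2 s a + stepVar P u s a)

lemma tendsto_stepMatrix_tiltKernel (π : S → A → ℝ) (σ2 : S → A → ℝ≥0) (P : S → A → S → ℝ)
    (c u : S → ℝ) :
    Filter.Tendsto (fun ε => stepMatrix (tiltKernel π σ2 P c u ε)) (𝓝[≠] 0)
      (𝓝 (policyMatrix π P)) := by
  have hc : Continuous fun ε => stepMatrix (tiltKernel π σ2 P c u ε) := by
    refine continuous_matrix fun s s' => ?_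
    simp only [stepMatrix, tiltKernel, of_apply]
    fun_prop
  have h0 : stepMatrix (tiltKernel π σ2 P c u 0) = policyMatrix π P := by
    rw [policyMatrix_eq_stepMatrix]
    simp [stepMatrix, tiltKernel]
  rw [← h0]
  exact (hc.tendsto 0).mono_left nhdsWithin_le_nhds

lemma stepMatrix_tiltKernel_mulVec_one (π : S → A → ℝ) (σ2 : S → A → ℝ≥0) {P : S → A → S → ℝ}
    (hP : IsTransition P) (c u : S → ℝ) (ε : ℝ) (s : S) :
    (stepMatrix (tiltKernel π σ2 P c u ε) *ᵥ 1) s = ∑ a, π s a *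
      (Real.exp (ε ^ 2 * (c s ^ 2 * σ2 s a)) * (1 + ε ^ 2 * (c s ^ 2 * stepVar P u s a))) := by
  rw [stepMatrix_mulVec]
  refine Finset.sum_congr rfl fun a _ => ?_
  have h : ∀ s', tiltKernel π σ2 P c u ε s a s' * (1 : S → ℝ) s' =
      π s a * Real.exp (ε ^ 2 * (c s ^ 2 * σ2 s a)) * (P s a s' +
        -- This linear term sums to zero because the score is centred, so the expansion starts at
        -- order `ε ^ 2`.
        2 * ε * (P s a s' * tiltScore P c u s a s') +
        ε ^ 2 * (P s a s' * tiltScore P c u s a s' ^ 2)) := fun s' => by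
    rw [tiltKernel, Pi.one_apply, mul_pow ε, mul_assoc (ε ^ 2)]
    ring
  simp_rw [h]
  rw [← Finset.mul_sum, Finset.sum_add_distrib, Finset.sum_add_distrib, ← Finset.mul_sum,
    ← Finset.mul_sum, hP.2, sum_mul_tiltScore hP, sum_mul_tiltScore_sq]
  ring

lemma tendsto_stepMatrix_tiltKernel_mulVec_one {π : S → A → ℝ} (hπ : IsPolicy π)
    (σ2 : S → A → ℝ≥0) {P : S → A → S → ℝ} (hP : IsTransition P) (c u : S → ℝ) :
    Filter.Tendsto
      (fun ε : ℝ => (ε ^ 2)⁻¹ • (stepMatrix (tiltKernel π σ2 P c u ε) *ᵥ 1 - 1)) (𝓝[≠] 0)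
      (𝓝 fun s => c s ^ 2 * infoVar π σ2 P u s) := by
  refine tendsto_pi_nhds.2 fun s => ?_
  have h := tendsto_finsetSum Finset.univ fun a (_ : a ∈ Finset.univ) =>
    (tendsto_exp_mul_sub_one_div_sq (c s ^ 2 * σ2 s a) (c s ^ 2 * stepVar P u s a)).const_mul
      (π s a)
  have e : ∑ a, π s a * (c s ^ 2 * σ2 s a + c s ^ 2 * stepVar P u s a) =
      c s ^ 2 * infoVar π σ2 P u s := by
    rw [infoVar, Finset.mul_sum]
    exact Finset.sum_congr rfl fun a _ => by ring
  rw [e] at h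
  refine h.congr fun ε => ?_
  rw [Pi.smul_apply, Pi.sub_apply, stepMatrix_tiltKernel_mulVec_one π σ2 hP, smul_eq_mul,
    Pi.one_apply, show ∀ y : ℝ, y - 1 = y - ∑ a, π s a from fun y => by rw [hπ.2 s],
    ← Finset.sum_sub_distrib, Finset.mul_sum]
  exact Finset.sum_congr rfl fun a _ => by ring

lemma tendsto_dotProduct_tiltKernel_pow [DecidableEq S] {π : S → A → ℝ} (hπ : IsPolicy π) (σ2 : S → A → ℝ≥0)
    {P : S → A → S → ℝ} (hP : IsTransition P) (c u : S → ℝ) {μ : S → ℝ}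
    (hμ : IsStationaryDist (policyMatrix π P) μ) (T : ℕ) :
    Filter.Tendsto (fun ε : ℝ =>
        (ε ^ 2)⁻¹ * (μ ⬝ᵥ (stepMatrix (tiltKernel π σ2 P c u ε) ^ T *ᵥ 1) - 1)) (𝓝[≠] 0)
      (𝓝 (T * ∑ s, μ s * (c s ^ 2 * infoVar π σ2 P u s))) := by
  have h := tendsto_pow_mulVec_one_sub_one (tendsto_stepMatrix_tiltKernel π σ2 P c u)
    (tendsto_stepMatrix_tiltKernel_mulVec_one hπ σ2 hP c u) T
  have hd : Continuous fun v : S → ℝ => μ ⬝ᵥ v := by unfold dotProduct; fun_prop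
  have h2 := (hd.tendsto _).comp h
  have e : μ ⬝ᵥ (∑ t ∈ Finset.range T,
      (policyMatrix π P ^ t) *ᵥ fun s => c s ^ 2 * infoVar π σ2 P u s) =
      T * ∑ s, μ s * (c s ^ 2 * infoVar π σ2 P u s) := by
    rw [dotProduct_sum]
    -- Stationarity makes all `T` terms of the sum equal.
    simp_rw [dotProduct_mulVec, hμ.vecMul_pow]
    simp [dotProduct]
  rw [e] at h2
  refine h2.congr fun ε => ?_
  simp only [Function.comp, dotProduct_smul, dotProduct_sub, dotProduct_one, hμ.2.1, smul_eq_mul]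

end TiltLimit

/-! ### The covariance of an estimator -/

lemma dotProduct_estimatorCov_mulVec {S Ω : Type*} [Fintype S] [MeasurableSpace Ω]
    {f : Ω → S → ℝ} {P : Measure Ω} [IsProbabilityMeasure P] (hf : MemLp f 2 P) (x : S → ℝ) :
    x ⬝ᵥ (estimatorCov f P *ᵥ x) = variance (fun τ => x ⬝ᵥ f τ) P := by
  have h : ∀ s, MemLp (fun τ => x s * f τ s) 2 P := fun s => (hf.eval s).const_mul (x s)
  have hm : AEMeasurable (fun τ => ∑ s, x s * f τ s) P :=
    (memLp_finsetSum Finset.univ fun s _ => h s).aestronglyMeasurable.aemeasurable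
  simp only [dotProduct]
  rw [← covariance_self hm, covariance_fun_sum_fun_sum h h]
  refine Finset.sum_congr rfl fun s _ => ?_
  rw [mulVec, dotProduct, Finset.mul_sum]
  refine Finset.sum_congr rfl fun s' _ => ?_
  rw [covariance_const_mul_left, covariance_const_mul_right, estimatorCov, of_apply]
  ring

lemma isHermitian_estimatorCov {S Ω : Type*} [MeasurableSpace Ω]
    (f : Ω → S → ℝ) (P : Measure Ω) : (estimatorCov f P).IsHermitian := by
  ext s s'
  simp [estimatorCov, covariance_comm]

lemma integral_dotProduct {S Ω : Type*} [Fintype S] [MeasurableSpace Ω] {f : Ω → S → ℝ}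
    {P : Measure Ω} (hf : Integrable f P) (x : S → ℝ) :
    ∫ τ, x ⬝ᵥ f τ ∂P = x ⬝ᵥ ∫ τ, f τ ∂P := by
  have h : ∀ s, Integrable (fun τ => f τ s) P := fun s => hf.eval s
  simp only [dotProduct]
  rw [integral_finsetSum _ fun s _ => (h s).const_mul (x s)]
  refine Finset.sum_congr rfl fun s _ => ?_
  rw [integral_const_mul, eval_integral h]

/-! ### The derivative of the value function along the submodel -/

section Local

set_option linter.unusedSectionVars false

variable {S A : Type*} [Fintype S] [Fintype A] [DecidableEq S] [MeasurableSpace S]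
  [MeasurableSpace A] [MeasurableSingletonClass S] [MeasurableSingletonClass A]

lemma policyMatrix_tiltParam_mulVec (π : S → A → ℝ) (σ2 : S → A → ℝ≥0) (c u : S → ℝ)
    (θ : MDPParam S A) (ε : ℝ) (v : S → ℝ) :
    policyMatrix π (tiltParam σ2 c u θ ε).1 *ᵥ v = policyMatrix π θ.1 *ᵥ v +
      ε • policyMatrix π (fun s a s' => θ.1 s a s' * tiltScore θ.1 c u s a s') *ᵥ v := by
  rw [← smul_mulVec, ← add_mulVec]
  congr 1
  ext s s'
  simp only [policyMatrix, tiltParam, of_apply, Matrix.add_apply, Matrix.smul_apply, smul_eq_mul,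
    Finset.mul_sum, ← Finset.sum_add_distrib]
  exact Finset.sum_congr rfl fun a _ => by ring

lemma policyMatrix_tiltScore_mulVec (π : S → A → ℝ) {P : S → A → S → ℝ} (hP : IsTransition P)
    (c u : S → ℝ) (s : S) :
    (policyMatrix π (fun s a s' => P s a s' * tiltScore P c u s a s') *ᵥ u) s =
      c s * ∑ a, π s a * stepVar P u s a := by
  rw [policyMatrix_eq_stepMatrix, stepMatrix_mulVec, Finset.mul_sum]
  refine Finset.sum_congr rfl fun a _ => ?_
  simp_rw [mul_assoc (π s a)]
  rw [← Finset.mul_sum, sum_mul_tiltScore_mul hP]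
  ring

/-- Continuity is enough for the slope, since the difference of two Bellman equations is an exact
identity. -/
lemma tendsto_valueFn_tiltParam {γ : ℝ} (hγ0 : 0 ≤ γ) (hγ1 : γ < 1) {π : S → A → ℝ}
    (hπ : IsPolicy π) (σ2 : S → A → ℝ≥0) (c u : S → ℝ) {θ : MDPParam S A}
    (hθ : IsTransition θ.1) :
    Filter.Tendsto (fun ε => valueFn γ π σ2 (tiltParam σ2 c u θ ε)) (𝓝 0)
      (𝓝 (valueFn γ π σ2 θ)) := by
  have hinv : ∀ θ' : MDPParam S A, IsTransition θ'.1 → valueFn γ π σ2 θ' =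
      (1 - γ • policyMatrix π θ'.1)⁻¹ *ᵥ fun s => ∑ a, π s a * θ'.2 s a := fun θ' h => by
    rw [← valueFn_bellman hγ0 hγ1 hπ σ2 h, mulVec_mulVec,
      nonsing_inv_mul _ ((isRowStochastic_policyMatrix hπ h).isUnit_det hγ0 hγ1), one_mulVec]
  have hp : Continuous fun θ' : MDPParam S A => policyMatrix π θ'.1 := by
    refine continuous_matrix fun s s' => ?_
    simp only [policyMatrix, of_apply]
    fun_prop
  have hM : Continuous fun θ' : MDPParam S A => 1 - γ • policyMatrix π θ'.1 :=
    continuous_const.sub (hp.const_smul γ)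
  have hr : Continuous fun θ' : MDPParam S A => fun s => ∑ a, π s a * θ'.2 s a := by fun_prop
  have hdet : ContinuousAt Ring.inverse (1 - γ • policyMatrix π θ.1).det := by
    rw [Ring.inverse_eq_inv']
    exact continuousAt_inv₀
      ((isRowStochastic_policyMatrix hπ hθ).isUnit_det hγ0 hγ1).ne_zero
  have hV := tendsto_mulVec ((continuousAt_matrix_inv _ hdet).tendsto.comp (hM.tendsto θ))
    (hr.tendsto θ)
  rw [hinv θ hθ]
  refine (hV.comp (tendsto_tiltParam σ2 c u θ)).congr' ?_
  filter_upwards [eventually_abs_tiltScore_le θ.1 c u] with ε hε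
  exact (hinv _ (isTransition_tiltParam σ2 c u hθ hε)).symm

lemma tendsto_valueFn_tiltParam_slope {γ : ℝ} (hγ0 : 0 ≤ γ) (hγ1 : γ < 1) {π : S → A → ℝ}
    (hπ : IsPolicy π) (σ2 : S → A → ℝ≥0) (c : S → ℝ) {θ : MDPParam S A}
    (hθ : IsTransition θ.1) (w : S → ℝ) :
    Filter.Tendsto (fun ε => ε⁻¹ * ((w ᵥ* (1 - γ • policyMatrix π θ.1)) ⬝ᵥ
        (valueFn γ π σ2 (tiltParam σ2 c (γ • valueFn γ π σ2 θ) θ ε) - valueFn γ π σ2 θ)))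
      (𝓝[≠] 0)
      (𝓝 (∑ s, w s * (c s * infoVar π σ2 θ.1 (γ • valueFn γ π σ2 θ) s))) := by
  set V := valueFn γ π σ2 θ with hVdef
  set H := policyMatrix π (fun s a s' => θ.1 s a s' * tiltScore θ.1 c (γ • V) s a s') with hH
  set ρ : S → ℝ := fun s => ∑ a, π s a * (c s * σ2 s a) with hρ
  have hlim : Filter.Tendsto (fun ε => w ⬝ᵥ
      (ρ + γ • (H *ᵥ valueFn γ π σ2 (tiltParam σ2 c (γ • V) θ ε)))) (𝓝[≠] 0)
      (𝓝 (w ⬝ᵥ (ρ + γ • (H *ᵥ V)))) := by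
    have hd : Continuous fun v : S → ℝ => w ⬝ᵥ (ρ + γ • (H *ᵥ v)) := by
      unfold dotProduct mulVec dotProduct
      simp only [Pi.add_apply, Pi.smul_apply]
      fun_prop
    exact (hd.tendsto V).comp ((tendsto_valueFn_tiltParam hγ0 hγ1 hπ σ2 c (γ • V) hθ).mono_left
      nhdsWithin_le_nhds)
  have e : w ⬝ᵥ (ρ + γ • (H *ᵥ V)) = ∑ s, w s * (c s * infoVar π σ2 θ.1 (γ • V) s) := by
    refine Finset.sum_congr rfl fun s _ => ?_
    rw [← mulVec_smul, Pi.add_apply, hH, policyMatrix_tiltScore_mulVec π hθ, infoVar, hρ]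
    simp only [Finset.mul_sum, ← Finset.sum_add_distrib]
    exact Finset.sum_congr rfl fun a _ => by ring
  rw [e] at hlim
  refine hlim.congr' ?_
  filter_upwards [self_mem_nhdsWithin,
    (eventually_abs_tiltScore_le θ.1 c (γ • V)).filter_mono nhdsWithin_le_nhds] with ε hε0 hε
  set Vε := valueFn γ π σ2 (tiltParam σ2 c (γ • V) θ ε)
  have b0 : (1 - γ • policyMatrix π θ.1) *ᵥ V = fun s => ∑ a, π s a * θ.2 s a :=
    valueFn_bellman hγ0 hγ1 hπ σ2 hθ
  have b1 : (1 - γ • policyMatrix π (tiltParam σ2 c (γ • V) θ ε).1) *ᵥ Vε =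
      fun s => ∑ a, π s a * (tiltParam σ2 c (γ • V) θ ε).2 s a :=
    valueFn_bellman hγ0 hγ1 hπ σ2 (isTransition_tiltParam σ2 c (γ • V) hθ hε)
  have b2 : (fun s => ∑ a, π s a * (tiltParam σ2 c (γ • V) θ ε).2 s a) =
      (fun s => ∑ a, π s a * θ.2 s a) + ε • ρ := by
    ext s
    simp only [tiltParam, hρ, Pi.add_apply, Pi.smul_apply, smul_eq_mul, Finset.mul_sum,
      ← Finset.sum_add_distrib]
    exact Finset.sum_congr rfl fun a _ => by ring
  rw [b2, ← b0, sub_mulVec, one_mulVec, smul_mulVec, policyMatrix_tiltParam_mulVec] at b1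
  -- Exact in `ε`: the perturbation `H` acts on `Vε`, and only the limit replaces it by `V`.
  have b3 : (1 - γ • policyMatrix π θ.1) *ᵥ (Vε - V) = ε • (ρ + γ • (H *ᵥ Vε)) := by
    rw [mulVec_sub, sub_eq_iff_eq_add, sub_mulVec _ _ Vε, one_mulVec, smul_mulVec,
      sub_eq_iff_eq_add]
    rw [smul_add, sub_eq_iff_eq_add] at b1
    refine b1.trans ?_
    rw [smul_add, smul_comm ε γ]
    abel
  rw [← dotProduct_mulVec, b3, dotProduct_smul, smul_eq_mul, ← mul_assoc, inv_mul_cancel₀ hε0,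
    one_mul]

/-! ### The information bound for locally unbiased estimators -/

lemma IsLocallyUnbiased.integral_eq {T : ℕ} {γ : ℝ} {π : S → A → ℝ} {σ2 : S → A → ℝ≥0}
    {ν : S → ℝ} {θ : MDPParam S A} (hθ : θ ∈ irreducibleModel π)
    {f : Trajectory S A T → S → ℝ} (hf : IsLocallyUnbiased γ π σ2 ν θ f) :
    ∫ τ, f τ ∂(trajLaw T π σ2 ν θ) = valueFn γ π σ2 θ := by
  -- As `θ` lies in the model, the little-o bound holds at `θ' = θ`, where its right side is zero.
  have h := (hf.2.def one_pos).self_of_nhdsWithin hθ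
  rwa [sub_self, norm_zero, mul_zero, norm_le_zero_iff, sub_eq_zero] at h

lemma IsLocallyUnbiased.tendsto_slope {T : ℕ} {γ : ℝ} {π : S → A → ℝ} (hπ : IsPolicy π)
    {σ2 : S → A → ℝ≥0} {ν : S → ℝ} {θ : MDPParam S A} (hθ : θ ∈ irreducibleModel π)
    {f : Trajectory S A T → S → ℝ} (hf : IsLocallyUnbiased γ π σ2 ν θ f) (c u x : S → ℝ) :
    Filter.Tendsto (fun ε => ε⁻¹ * (x ⬝ᵥ
      ((∫ τ, f τ ∂(trajLaw T π σ2 ν (tiltParam σ2 c u θ ε))) -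
        valueFn γ π σ2 (tiltParam σ2 c u θ ε)))) (𝓝[≠] 0) (𝓝 0) := by
  have ht : Filter.Tendsto (tiltParam σ2 c u θ) (𝓝[≠] 0) (𝓝[irreducibleModel π] θ) :=
    tendsto_nhdsWithin_iff.2 ⟨(tendsto_tiltParam σ2 c u θ).mono_left nhdsWithin_le_nhds,
      (eventually_tiltParam_mem hπ σ2 c u hθ).filter_mono nhdsWithin_le_nhds⟩
  have h1 := hf.2.comp_tendsto ht
  have h2 : (fun ε => tiltParam σ2 c u θ ε - θ) =O[𝓝[≠] 0] fun ε : ℝ => ε := by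
    simp_rw [tiltParam_sub]
    exact IsBigO.of_bound _ (Filter.Eventually.of_forall fun ε => by
      rw [norm_smul, mul_comm])
  have h3 := (h1.trans_isBigO h2).tendsto_inv_smul_nhds_zero
  have hd : Continuous fun v : S → ℝ => x ⬝ᵥ v := by unfold dotProduct; fun_prop
  have h4 := (hd.tendsto 0).comp h3
  rw [dotProduct_zero] at h4
  refine h4.congr fun ε => ?_
  simp only [Function.comp, dotProduct_smul, smul_eq_mul]

/-- The covariance bound for estimators that are unbiased to first order. The asymptotic variance
involves the transition laws of the individual actions. -/
theorem posSemidef_sub_of_isLocallyUnbiased {T : ℕ} (hT : 0 < T) {γ : ℝ} (hγ0 : 0 ≤ γ)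
    (hγ1 : γ < 1) {π : S → A → ℝ} (hπ : IsPolicy π) {σ2 : S → A → ℝ≥0} {θ : MDPParam S A}
    (hθ : θ ∈ irreducibleModel π) {μ : S → ℝ} (hμ : IsStationaryDist (policyMatrix π θ.1) μ)
    {f : Trajectory S A T → S → ℝ} (hf : MemLp f 2 (trajLaw T π σ2 μ θ))
    (hunb : IsLocallyUnbiased γ π σ2 μ θ f) :
    ((T : ℝ) • estimatorCov f (trajLaw T π σ2 μ θ) -
      (1 - γ • policyMatrix π θ.1)⁻¹ *
        Matrix.diagonal (fun s => infoVar π σ2 θ.1 (γ • valueFn γ π σ2 θ) s / μ s) *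
        ((1 - γ • policyMatrix π θ.1)⁻¹)ᵀ).PosSemidef := by
  have hprob := isProbabilityMeasure_trajLaw T hπ σ2 hμ.1 hμ.2.1 hθ.1
  have hQ := isRowStochastic_policyMatrix hπ hθ.1
  have hμpos : ∀ s, 0 < μ s := hμ.pos hQ.1 hθ.2
  have hdet := hQ.isUnit_det hγ0 hγ1
  set M := 1 - γ • policyMatrix π θ.1 with hM
  set V := valueFn γ π σ2 θ with hV
  set B := infoVar π σ2 θ.1 (γ • V) with hB
  refine posSemidef_iff_dotProduct_mulVec.2 ⟨?_, fun x => ?_⟩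
  · refine ((isHermitian_estimatorCov f _).smul (IsSelfAdjoint.all _)).sub ?_
    have := isHermitian_mul_mul_conjTranspose M⁻¹
      (isHermitian_diagonal (fun s => B s / μ s))
    rwa [conjTranspose_eq_transpose_of_trivial] at this
  set w := x ᵥ* M⁻¹ with hw
  -- With this choice the slope `∑ w c B` and the information per step `∑ μ c² B` are the same
  -- number `J`.
  set c : S → ℝ := fun s => w s / μ s with hc
  set J := ∑ s, w s ^ 2 * (B s / μ s) with hJ
  have hwx : w ᵥ* M = x := by
    rw [hw, vecMul_vecMul, nonsing_inv_mul _ hdet, vecMul_one]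
  have hquad : x ⬝ᵥ ((M⁻¹ * Matrix.diagonal (fun s => B s / μ s) * (M⁻¹)ᵀ) *ᵥ x) = J := by
    rw [← mulVec_mulVec, ← mulVec_mulVec, mulVec_transpose, dotProduct_mulVec, ← hw, hJ]
    refine Finset.sum_congr rfl fun s _ => ?_
    rw [mulVec_diagonal]
    ring
  have hJ1 : ∑ s, w s * (c s * B s) = J := Finset.sum_congr rfl fun s _ => by
    rw [hc]; ring
  have hJ2 : ∑ s, μ s * (c s ^ 2 * B s) = J := Finset.sum_congr rfl fun s _ => by
    have := (hμpos s).ne'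
    simp only [hc]
    field_simp
  have hX : MemLp (fun τ => x ⬝ᵥ f τ) 2 (trajLaw T π σ2 μ θ) := by
    simp only [dotProduct]
    exact memLp_finsetSum Finset.univ fun s _ => (hf.eval s).const_mul (x s)
  rw [star_trivial, sub_mulVec, dotProduct_sub, smul_mulVec, dotProduct_smul,
    dotProduct_estimatorCov_mulVec hf, hquad, smul_eq_mul]
  set E : ℝ → ℝ := fun ε => ∫ τ, x ⬝ᵥ f τ ∂(trajLaw T π σ2 μ (tiltParam σ2 c (γ • V) θ ε))
  set E₀ := ∫ τ, x ⬝ᵥ f τ ∂(trajLaw T π σ2 μ θ) with hE₀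
  have hE₀' : E₀ = x ⬝ᵥ V := by
    rw [hE₀, integral_dotProduct (hf.integrable (by norm_num)), hunb.integral_eq hθ]
  have hslope : Filter.Tendsto (fun ε => ε⁻¹ * (E ε - E₀)) (𝓝[≠] 0) (𝓝 J) := by
    have h1 := tendsto_valueFn_tiltParam_slope hγ0 hγ1 hπ σ2 c hθ.1 w
    have h2 := hunb.tendsto_slope hπ hθ c (γ • V) x
    rw [← hM, ← hV, hwx, ← hB, hJ1] at h1
    have h3 := h1.add h2
    rw [add_zero] at h3
    have ht : Filter.Tendsto (tiltParam σ2 c (γ • V) θ) (𝓝[≠] 0) (𝓝[irreducibleModel π] θ) :=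
      tendsto_nhdsWithin_iff.2 ⟨(tendsto_tiltParam σ2 c _ θ).mono_left nhdsWithin_le_nhds,
        (eventually_tiltParam_mem hπ σ2 c _ hθ).filter_mono nhdsWithin_le_nhds⟩
    refine h3.congr' ?_
    filter_upwards [ht.eventually hunb.1] with ε hε
    simp only [E]
    rw [integral_dotProduct hε, hE₀', ← mul_add, ← dotProduct_add, ← dotProduct_sub]
    congr 2
    abel
  have hsq := tendsto_dotProduct_tiltKernel_pow hπ σ2 hθ.1 c (γ • V) hμ T
  rw [← hB, hJ2] at hsq
  have hTR : (0 : ℝ) < T := by exact_mod_cast hT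
  have hlim := ((hslope.const_mul (2 * (T : ℝ)⁻¹)).const_sub
    (variance (fun τ => x ⬝ᵥ f τ) (trajLaw T π σ2 μ θ))).add (hsq.const_mul ((T : ℝ)⁻¹ ^ 2))
  have hnonneg := ge_of_tendsto hlim (b := 0) (by
    filter_upwards [(eventually_abs_tiltScore_le θ.1 c (γ • V)).filter_mono
      nhdsWithin_le_nhds] with ε hε
    -- The limit is `variance - 2 k J + k² T J` for the multiplier `k / ε`, and `k = 1 / T`
    -- minimizes it.
    have h := variance_tilt_quadratic_nonneg hπ hμ.1 hμ.2.1 hθ.1 c (γ • V)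
      (isTransition_tiltParam σ2 c (γ • V) hθ.1 hε) hX ((T : ℝ)⁻¹ * ε⁻¹)
    refine h.trans (le_of_eq ?_)
    simp only [E, E₀, inv_pow]
    ring)
  have e : variance (fun τ => x ⬝ᵥ f τ) (trajLaw T π σ2 μ θ) - 2 * (T : ℝ)⁻¹ * J +
      (T : ℝ)⁻¹ ^ 2 * (T * J) =
      (T : ℝ)⁻¹ * (T * variance (fun τ => x ⬝ᵥ f τ) (trajLaw T π σ2 μ θ) - J) := by
    field_simp
    ring
  rw [e] at hnonneg
  exact nonneg_of_mul_nonneg_right hnonneg (inv_pos.2 hTR)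

lemma IsUnbiased.isLocallyUnbiased {T : ℕ} {γ : ℝ} {π : S → A → ℝ} {σ2 : S → A → ℝ≥0}
    {ν : S → ℝ} {f : Trajectory S A T → S → ℝ} (hf : IsUnbiased γ π σ2 ν f)
    (θ : MDPParam S A) : IsLocallyUnbiased γ π σ2 ν θ f := by
  refine ⟨eventually_nhdsWithin_of_forall fun θ' h => (hf θ' h).1, ?_⟩
  refine (isLittleO_zero _ _).congr' ?_ Filter.EventuallyEq.rfl
  exact eventually_nhdsWithin_of_forall fun θ' h => by simp [(hf θ' h).2]

lemma dotProduct_multinomialCov_mulVec (p u : S → ℝ) :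
    u ⬝ᵥ (multinomialCov p *ᵥ u) = (∑ s, p s * u s ^ 2) - (p ⬝ᵥ u) ^ 2 := by
  rw [multinomialCov, sub_mulVec, dotProduct_sub, vecMulVec_mulVec]
  congr 1
  · refine Finset.sum_congr rfl fun s _ => ?_
    rw [mulVec_diagonal]
    ring
  · rw [op_smul_eq_smul, dotProduct_smul, smul_eq_mul, dotProduct_comm u p, sq]

/-- If the one-step variance averages over the actions to the variance under the averaged
transition law, then the covariance bound is `sigmaMB`. -/
lemma posSemidef_sub_sigmaMB {T : ℕ} (hT : 0 < T) {γ : ℝ} (hγ0 : 0 ≤ γ)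
    (hγ1 : γ < 1) {π : S → A → ℝ} (hπ : IsPolicy π) {σ2 : S → A → ℝ≥0} {θ : MDPParam S A}
    (hθ : θ ∈ irreducibleModel π) {μ : S → ℝ} (hμ : IsStationaryDist (policyMatrix π θ.1) μ)
    (hvar : ∀ s, ∑ a, π s a * stepVar θ.1 (γ • valueFn γ π σ2 θ) s a =
      (γ • valueFn γ π σ2 θ) ⬝ᵥ
        (multinomialCov (policyMatrix π θ.1 s) *ᵥ (γ • valueFn γ π σ2 θ)))
    {f : Trajectory S A T → S → ℝ} (hf : MemLp f 2 (trajLaw T π σ2 μ θ))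
    (hunb : IsLocallyUnbiased γ π σ2 μ θ f) :
    ((T : ℝ) • estimatorCov f (trajLaw T π σ2 μ θ) - sigmaMB γ π σ2 μ θ).PosSemidef := by
  have h := posSemidef_sub_of_isLocallyUnbiased hT hγ0 hγ1 hπ hθ hμ hf hunb
  have e : (fun s => infoVar π σ2 θ.1 (γ • valueFn γ π σ2 θ) s / μ s) = fun s =>
      policyVar π σ2 s / μ s + ((γ • valueFn γ π σ2 θ) ⬝ᵥ
        (multinomialCov (policyMatrix π θ.1 s) *ᵥ (γ • valueFn γ π σ2 θ))) / μ s := by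
    ext s
    rw [← hvar, ← add_div, infoVar, policyVar, ← Finset.sum_add_distrib]
    simp only [mul_add]
  rw [e] at h
  exact h

/-- The gap is the variance over actions of the conditional mean of `u`; it vanishes here, since
actions of probability zero carry no weight. -/
lemma sum_mul_stepVar_eq_of_eq {π : S → A → ℝ} (hπ : IsPolicy π) {P : S → A → S → ℝ}
    (hP : IsTransition P) (h : ∀ s a, π s a ≠ 0 → ∀ s', P s a s' = policyMatrix π P s s')
    (u : S → ℝ) (s : S) :
    ∑ a, π s a * stepVar P u s a = u ⬝ᵥ (multinomialCov (policyMatrix π P s) *ᵥ u) := by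
  have key : ∀ a, π s a * stepVar P u s a =
      π s a * (u ⬝ᵥ (multinomialCov (policyMatrix π P s) *ᵥ u)) := fun a => by
    by_cases ha : π s a = 0
    · rw [ha, zero_mul, zero_mul]
    · rw [stepVar_eq hP, dotProduct_multinomialCov_mulVec, funext (h s a ha)]
  simp_rw [key]
  rw [← Finset.sum_mul, hπ.2, one_mul]

/-! ### Nonexistence of unbiased estimators -/

/-- The parameter under which the state is kept with probability `t` and drawn uniformly
otherwise, and the reward is the indicator of the state `s₀`. -/
noncomputable def lazyParam (A : Type*) (s₀ : S) (t : ℝ) : MDPParam S A :=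
  (fun s _ s' => (1 - t) * (Fintype.card S : ℝ)⁻¹ + t * (if s = s' then 1 else 0),
    fun s _ => if s = s₀ then 1 else 0)

lemma policyMatrix_lazyParam {π : S → A → ℝ} (hπ : IsPolicy π) (s₀ : S) (t : ℝ) (s s' : S) :
    policyMatrix π (lazyParam A s₀ t).1 s s' =
      (1 - t) * (Fintype.card S : ℝ)⁻¹ + t * (if s = s' then 1 else 0) := by
  simp only [policyMatrix, lazyParam, of_apply]
  rw [← Finset.mul_sum, hπ.2, mul_one]

lemma lazyParam_mem {π : S → A → ℝ} (hπ : IsPolicy π) (s₀ : S) {t : ℝ} (ht0 : 0 < t)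
    (ht1 : t < 1) : lazyParam A s₀ t ∈ irreducibleModel π := by
  have hn : (0 : ℝ) < Fintype.card S := by
    exact_mod_cast Fintype.card_pos_iff.2 ⟨s₀⟩
  have hn' := inv_pos.2 hn
  have hpos : ∀ s s' : S,
      0 < (1 - t) * (Fintype.card S : ℝ)⁻¹ + t * (if s = s' then 1 else 0) := fun s s' => by
    have := mul_pos (sub_pos.2 ht1) hn'
    split_ifs <;> linarith
  refine ⟨⟨fun s a s' => (hpos s s').le, fun s a => ?_⟩, fun s s' => ⟨1, ?_⟩⟩
  · simp only [lazyParam]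
    rw [Finset.sum_add_distrib, ← Finset.mul_sum]
    simp [hn.ne']
  · rw [pow_one, policyMatrix_lazyParam hπ]
    exact hpos s s'

/-- Constants and the centred indicator of `s₀` are eigenvectors of the chain, with eigenvalues `1`
and `t`, so the Bellman equation is solved by hand. Multiplying by `1 - γ * t` clears the
denominator that depends on `t`. -/
lemma valueFn_lazyParam {γ : ℝ} (hγ0 : 0 ≤ γ) (hγ1 : γ < 1) {π : S → A → ℝ} (hπ : IsPolicy π)
    (σ2 : S → A → ℝ≥0) (s₀ : S) {t : ℝ} (ht0 : 0 < t) (ht1 : t < 1) :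
    (1 - γ * t) * valueFn γ π σ2 (lazyParam A s₀ t) s₀ =
      (1 - γ * t) * ((Fintype.card S : ℝ)⁻¹ / (1 - γ)) + (1 - (Fintype.card S : ℝ)⁻¹) := by
  have hn : (Fintype.card S : ℝ) ≠ 0 := by
    exact_mod_cast (Fintype.card_pos_iff.2 ⟨s₀⟩).ne'
  have h1 : 1 - γ ≠ 0 := by linarith
  have h2 : 1 - γ * t ≠ 0 := by nlinarith
  rw [← eq_valueFn_of_bellman (V := fun s => (Fintype.card S : ℝ)⁻¹ / (1 - γ) +
    (1 - γ * t)⁻¹ * ((if s = s₀ then 1 else 0) - (Fintype.card S : ℝ)⁻¹))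
    hγ0 hγ1 hπ σ2 (lazyParam_mem hπ s₀ ht0 ht1).1]
  · simp only [if_true]
    field_simp
  · ext s
    rw [sub_mulVec, one_mulVec, smul_mulVec, Pi.sub_apply, Pi.smul_apply, smul_eq_mul, mulVec,
      dotProduct]
    simp only [policyMatrix_lazyParam hπ, add_mul, Finset.sum_add_distrib, mul_assoc,
      ← Finset.mul_sum, ite_mul, one_mul, zero_mul, Finset.sum_ite_eq, Finset.mem_univ, if_true,
      Finset.sum_sub_distrib, Finset.sum_const, Finset.card_univ, nsmul_eq_mul,
      Finset.sum_ite_eq']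
    simp only [lazyParam]
    rw [← Finset.sum_mul, hπ.2]
    field_simp
    ring

lemma pathProb_lazyParam_eq_eval {T : ℕ} (π : S → A → ℝ) (ν : S → ℝ) (s₀ : S) (t : ℝ)
    (s : Fin (T + 1) → S) (a : Fin T → A) :
    pathProb π ν (lazyParam A s₀ t).1 s a =
      (Polynomial.C (ν (s 0)) * ∏ i : Fin T, Polynomial.C (π (s i.castSucc) (a i)) *
        ((1 - Polynomial.X) * Polynomial.C (Fintype.card S : ℝ)⁻¹ +
          Polynomial.X * Polynomial.C (if s i.castSucc = s i.succ then 1 else 0))).eval t := by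
  simp only [pathProb, lazyParam, Polynomial.eval_mul, Polynomial.eval_C, Polynomial.eval_prod,
    Polynomial.eval_add, Polynomial.eval_sub, Polynomial.eval_one, Polynomial.eval_X]

/-- With at least two states and a positive discount factor the value function is not a
polynomial in the transition probabilities, so it has no unbiased estimator. -/
lemma not_isUnbiased [Nontrivial S] {T : ℕ} {γ : ℝ} (hγ0 : 0 < γ) (hγ1 : γ < 1)
    {π : S → A → ℝ} (hπ : IsPolicy π) {σ2 : S → A → ℝ≥0} {ν : S → ℝ} (hν : ∀ s, 0 ≤ ν s)
    (f : Trajectory S A T → S → ℝ) : ¬ IsUnbiased γ π σ2 ν f := by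
  intro hf
  obtain ⟨s₀⟩ : Nonempty S := inferInstance
  -- The mean rewards of `lazyParam` do not depend on `t`, so the inner integrals, taken at `t = 0`,
  -- are constants.
  set p : Polynomial ℝ := ∑ s : Fin (T + 1) → S, ∑ a : Fin T → A,
    (Polynomial.C (ν (s 0)) * ∏ i : Fin T, Polynomial.C (π (s i.castSucc) (a i)) *
        ((1 - Polynomial.X) * Polynomial.C (Fintype.card S : ℝ)⁻¹ +
          Polynomial.X * Polynomial.C (if s i.castSucc = s i.succ then 1 else 0))) *
      Polynomial.C ((∫ x, f (s, a, x) ∂(rewardLaw σ2 (lazyParam A s₀ 0).2 s a)) s₀) with hp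
  have hpe : ∀ t : ℝ, 0 < t → t < 1 →
      p.eval t = valueFn γ π σ2 (lazyParam A s₀ t) s₀ := fun t ht0 ht1 => by
    have hmem := lazyParam_mem (A := A) hπ s₀ ht0 ht1
    rw [← (hf _ hmem).2, integral_trajLaw hπ hν hmem.1 (hf _ hmem).1, hp]
    simp only [Polynomial.eval_finsetSum, Polynomial.eval_mul (p := Polynomial.C _ * _),
      ← pathProb_lazyParam_eq_eval (s₀ := s₀), Polynomial.eval_C, Finset.sum_apply, Pi.smul_apply,
      smul_eq_mul]
    rfl
  set q : Polynomial ℝ := (1 - Polynomial.C γ * Polynomial.X) * p -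
    ((1 - Polynomial.C γ * Polynomial.X) * Polynomial.C ((Fintype.card S : ℝ)⁻¹ / (1 - γ)) +
      Polynomial.C (1 - (Fintype.card S : ℝ)⁻¹)) with hq
  have hq0 : q = 0 := by
    refine Polynomial.eq_zero_of_infinite_isRoot q
      ((Set.Ioo_infinite (zero_lt_one (α := ℝ))).mono fun t ht => ?_)
    have h := valueFn_lazyParam hγ0.le hγ1 hπ σ2 s₀ ht.1 ht.2
    rw [← hpe t ht.1 ht.2] at h
    change Polynomial.eval t q = 0
    simp only [hq, Polynomial.eval_sub, Polynomial.eval_mul,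
      Polynomial.eval_add, Polynomial.eval_C, Polynomial.eval_X, Polynomial.eval_one]
    linarith
  -- The identity holds on `(0, 1)`, hence everywhere. At the pole `γ⁻¹` it leaves `1 - 1 / card S =
  -- 0`, impossible with two states.
  have h := congrArg (Polynomial.eval γ⁻¹) hq0
  simp only [hq, Polynomial.eval_sub, Polynomial.eval_mul, Polynomial.eval_add,
    Polynomial.eval_C, Polynomial.eval_X, Polynomial.eval_one, Polynomial.eval_zero,
    mul_inv_cancel₀ hγ0.ne', sub_self, zero_mul, zero_add, zero_sub, neg_eq_zero, sub_eq_zero] at h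
  have h1 : (1 : ℝ) < Fintype.card S := by exact_mod_cast Fintype.one_lt_card
  exact (inv_lt_one_of_one_lt₀ h1).ne' h

end Local

/-! ### The two efficiency bounds -/

theorem mainTheorem8 {S A : Type*} [Fintype S] [Fintype A] [DecidableEq S]
    [MeasurableSpace S] [MeasurableSingletonClass S]
    [MeasurableSpace A] [MeasurableSingletonClass A]
    (T : ℕ) (hT : 0 < T) (γ : ℝ) (hγ0 : 0 ≤ γ) (hγ1 : γ < 1)
    (π : S → A → ℝ) (hπ : IsPolicy π) (σ2 : S → A → ℝ≥0)
    (θ : MDPParam S A) (hθ : θ ∈ irreducibleModel π)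
    (μ : S → ℝ) (hμ : IsStationaryDist (policyMatrix π θ.1) μ) :
    (∀ f : Trajectory S A T → S → ℝ, Measurable f →
      MemLp f 2 (trajLaw T π σ2 μ θ) →
      IsUnbiased γ π σ2 μ f →
      ((T : ℝ) • estimatorCov f (trajLaw T π σ2 μ θ) - sigmaMB γ π σ2 μ θ).PosSemidef) ∧
    ((∀ s a, π s a ≠ 0 → ∀ s', θ.1 s a s' = policyMatrix π θ.1 s s') →
      ∀ f : Trajectory S A T → S → ℝ, Measurable f →
      MemLp f 2 (trajLaw T π σ2 μ θ) →
      IsLocallyUnbiased γ π σ2 μ θ f →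
      ((T : ℝ) • estimatorCov f (trajLaw T π σ2 μ θ) - sigmaMB γ π σ2 μ θ).PosSemidef) := by
  have hlocal : (∀ s a, π s a ≠ 0 → ∀ s', θ.1 s a s' = policyMatrix π θ.1 s s') →
      ∀ f : Trajectory S A T → S → ℝ, Measurable f →
      MemLp f 2 (trajLaw T π σ2 μ θ) →
      IsLocallyUnbiased γ π σ2 μ θ f →
      ((T : ℝ) • estimatorCov f (trajLaw T π σ2 μ θ) - sigmaMB γ π σ2 μ θ).PosSemidef :=
    fun hsame f _ hf hunb => posSemidef_sub_sigmaMB hT hγ0 hγ1 hπ hθ hμ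
      (sum_mul_stepVar_eq_of_eq hπ hθ.1 hsame _) hf hunb
  refine ⟨fun f hm hf hunb => ?_, hlocal⟩
  rcases hγ0.eq_or_lt with h0 | h0
  -- For `γ = 0` the function `γ • V` is zero and both variances vanish.
  · refine posSemidef_sub_sigmaMB hT hγ0 hγ1 hπ hθ hμ (fun s => ?_) hf (hunb.isLocallyUnbiased θ)
    simp [← h0, stepVar]
  rcases subsingleton_or_nontrivial S with hS | hS
  -- With at most one state every transition probability is one, so all actions share their law.
  · refine hlocal (fun s a _ s' => ?_) f hm hf (hunb.isLocallyUnbiased θ)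
    have h1 := hθ.1.2 s a
    have h2 := (isRowStochastic_policyMatrix hπ hθ.1).2 s
    rw [Fintype.sum_subsingleton _ s'] at h1 h2
    rw [h1, h2]
  · exact absurd hunb (not_isUnbiased h0 hγ1 hπ hμ.1 f)
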